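/- Let $n\ge 6$ be divisible by $3$, let $p\in\mathbb N$, and let $X=(X_1,\dots,X_n)$ have independent columns $X_t\sim N_p(\theta_t,\Sigma)$, where $\Sigma\in\mathbb R^{p\times p}$ is positive definite and the mean matrix $\theta=(\theta_1,\dots,\theta_n)\in\mathbb R^{p\times n}$ has at most one changepoint. That is, $\theta\in\Theta(p,n,p,0):=\Theta_0(p,n)\cup\bigcup_{\rho>0}\Theta(p,n,p,\rho)$, where $\Theta_0(p,n)$ is the set of $\theta$ with all columns equal, and $\Theta(p,n,s,\rho)$ is the set of $\theta$ for which there are $t_0\in\{1,\dots,n-1\}$ and $\mu_1,\mu_2\in\mathbb R^p$ with $\theta_t=\mu_1$ for $t\le t_0$, $\theta_t=\mu_2$ for $t>t_0$, at most $s$ coordinates of $\mu_1-\mu_2$ nonzero, and $\frac{t_0(n-t_0)}{n}\|\mu_1-\mu_2\|^2\ge\rho^2$. Write $\mathbb P_\theta$ for the law of $X$. Divide $\{1,\dots,n\}$ into three consecutive blocks $\mathcal D_1,\mathcal D_2,\mathcal D_3$ of size $n/3$, and for $j=1,2,3$ let $$\widehat\Sigma_{\mathcal D_j}:=\frac1{|\mathcal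 D_j|-1}\sum_{t\in\mathcal D_j}(X_t-\bar X_{\mathcal D_j})(X_t-\bar X_{\mathcal D_j})^T,\qquad \bar X_{\mathcal D_j}:=\frac1{|\mathcal D_j|}\sum_{t\in\mathcal D_j}X_t .$$ Let $\mathrm{Tr}(\widehat\Sigma)^{(2)}$, $\|\widehat\Sigma\|_F^{(2)}$ and $\|\widehat\Sigma\|_{op}^{(2)}$ be the medians (second smallest values) over $j=1,2,3$ of the trace, the Frobenius norm and the operator norm (largest singular value) of $\widehat\Sigma_{\mathcal D_j}$, respectively. Then for every $c>0$ and every $\epsilon>0$ there exists $C>0$, depending only on $c$ and $\epsilon$, such that for all such $n$ and $p$ with $p\le cn$, all positive definite $\Sigma$ and all $\theta\in\Theta(p,n,p,0)$, with $\mathbb P_\theta$-probability at least $1-\epsilon/4$ the following three inequalities hold simultaneously: $$\bigl|\mathrm{Tr}(\widehat\Sigma)^{(2)}-\mathrm{Tr}(\Sigma)\bigr|\le C\left(\frac{\sqrt p\,\|\Sigma\|_F}{\sqrt n}+\frac{p\,\|\Sigma\|_{op}}{n}\right),$$ $$\bigl|\|\widehat\Sigma\|_F^{(2)}-\|\Sigma\|_F\bigr|\le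 C\|\Sigma\|_{op}\sqrt{\frac{p^2}{n}},\qquad \bigl|\|\widehat\Sigma\|_{op}^{(2)}-\|\Sigma\|_{op}\bigr|\le C\|\Sigma\|_{op}\sqrt{\frac pn}.$$ -/

import Mathlib

open MeasureTheory ProbabilityTheory

namespace Changepoint

noncomputable section

/-- A `p × n` real matrix, stored as the family of its `n` columns in `ℝ^p`. The columns are indexed
by `Fin n`, so the column with index `t` is the one at time `t + 1`. -/
abbrev Cols (p n : ℕ) : Type := Fin n → EuclideanSpace ℝ (Fin p)

/-- The number of nonzero coordinates of a vector. -/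
def zeroNorm {p : ℕ} (v : EuclideanSpace ℝ (Fin p)) : ℕ :=
  (Finset.univ.filter fun i : Fin p => v i ≠ 0).card

/-- `Θ₀(p, n)`: mean matrices without a changepoint. -/
def nullSpace (p n : ℕ) : Set (Cols p n) :=
  {θ | ∃ μ : EuclideanSpace ℝ (Fin p), ∀ t, θ t = μ}

/-- `Θ^(t₀)(p, n, s, ρ)`: the mean is `μ₁` at times `1, …, t₀` and `μ₂` at times `t₀ + 1, …, n`,
with a change in at most `s` coordinates and of normalised size at least `ρ`. -/
def changeSpaceAt (p n s : ℕ) (ρ : ℝ) (t₀ : ℕ) : Set (Cols p n) :=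
  {θ | ∃ μ₁ μ₂ : EuclideanSpace ℝ (Fin p),
    (∀ t : Fin n, (t : ℕ) + 1 ≤ t₀ → θ t = μ₁) ∧
    (∀ t : Fin n, t₀ + 1 ≤ (t : ℕ) + 1 → θ t = μ₂) ∧
    zeroNorm (μ₁ - μ₂) ≤ s ∧
    ρ ^ 2 ≤ (t₀ : ℝ) * ((n : ℝ) - (t₀ : ℝ)) / (n : ℝ) * ‖μ₁ - μ₂‖ ^ 2}

/-- `Θ(p, n, s, ρ)`, the union of `Θ^(t₀)(p, n, s, ρ)` over `1 ≤ t₀ ≤ n - 1`. -/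
def changeSpace (p n s : ℕ) (ρ : ℝ) : Set (Cols p n) :=
  {θ | ∃ t₀ : ℕ, 1 ≤ t₀ ∧ t₀ < n ∧ θ ∈ changeSpaceAt p n s ρ t₀}

/-- `Θ(p, n, s, 0) = Θ₀(p, n) ∪ ⋃_{ρ > 0} Θ(p, n, s, ρ)`: at most one changepoint. -/
def paramSpace (p n s : ℕ) : Set (Cols p n) :=
  nullSpace p n ∪ ⋃ (ρ : ℝ) (_ : 0 < ρ), changeSpace p n s ρ

/-- The law `ℙ_θ` of the data matrix: independent columns `X_t ∼ N_p(θ_t, Σ)`. -/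
def dataLaw {p n : ℕ} (S : Matrix (Fin p) (Fin p) ℝ) (θ : Cols p n) : Measure (Cols p n) :=
  Measure.pi fun t => multivariateGaussian (θ t) S

/-- The `j`-th of the three consecutive blocks of length `n / 3` of the time indices
(used for `n` divisible by `3`). -/
def block (n : ℕ) (j : Fin 3) : Finset (Fin n) :=
  Finset.univ.filter fun t : Fin n => (j : ℕ) * (n / 3) ≤ t ∧ (t : ℕ) < ((j : ℕ) + 1) * (n / 3)

/-- The sample mean of the columns with index in `D`. -/
def sampleMean {p n : ℕ} (D : Finset (Fin n)) (X : Cols p n) : EuclideanSpace ℝ (Fin p) :=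
  ((D.card : ℝ)⁻¹) • ∑ t ∈ D, X t

/-- The sample covariance matrix of the columns with index in `D`. -/
def sampleCov {p n : ℕ} (D : Finset (Fin n)) (X : Cols p n) : Matrix (Fin p) (Fin p) ℝ :=
  (((D.card : ℝ) - 1)⁻¹) •
    ∑ t ∈ D, Matrix.vecMulVec (X t - sampleMean D X).ofLp (X t - sampleMean D X).ofLp

/-- The Frobenius norm. -/
def frobNorm {p : ℕ} (A : Matrix (Fin p) (Fin p) ℝ) : ℝ :=
  Real.sqrt (∑ i, ∑ j, A i j * A i j)

/-- The operator norm with respect to the Euclidean norm, i.e. the largest singular value. -/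
def opNorm {p : ℕ} (A : Matrix (Fin p) (Fin p) ℝ) : ℝ :=
  ‖Matrix.toEuclideanCLM (n := Fin p) (𝕜 := ℝ) A‖

/-- The median of three reals: the middle entry after sorting in increasing order. -/
def median (a : Fin 3 → ℝ) : ℝ := a (Tuple.sort a 1)

/-- The median over the three blocks of a functional `F` of the block sample covariances. -/
def medianOver {p n : ℕ} (F : Matrix (Fin p) (Fin p) ℝ → ℝ) (X : Cols p n) : ℝ :=
  median fun j => F (sampleCov (block n j) X)

end

end Changepoint

namespace Changepoint

open scoped RealInnerProductSpace ENNReal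

/-! A single changepoint spoils at most one of the three blocks, and a median of three lies between
the two other values when the spoiled one is in the middle (`abs_median_sub_le`). So it suffices to
control each functional on a block of size `m = n / 3` where the mean is constant, and there only
the centred noise `W` matters.

On such a block `sampleCov_sub_eq` writes the error as `(m - 1)⁻¹ (A + Σ - v vᵀ / m)`, with `A = ∑
W_t W_tᵀ - m Σ` and `v = ∑ W_t`. Markov's inequality for second moments gives, up to constants,
`‖v‖² ≲ m Tr Σ` and `|Tr A|, ‖A‖_F ≲ √m Tr Σ`. These crude bounds suffice because `Tr Σ ≤ √p ‖Σ‖_F ≤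
p ‖Σ‖_op`.

The operator norm of `A` needs exponential moments. Each `wᵀ A w` is a centred, scaled chi-square
sum, and a uniform bound over directions comes from integrating its exponential over a ball of `w`:
a large norm makes `|wᵀ A w|` large on a whole small ball. The resulting factor `16 ^ p` is absorbed
using `p ≤ c n` (`exists_noiseLaw_opNorm_le`). A union bound over the blocks finishes. -/

/-- The law of the centred data matrix: independent columns `W_t ∼ N_p(0, Σ)`. -/
noncomputable def noiseLaw {p : ℕ} (n : ℕ) (S : Matrix (Fin p) (Fin p) ℝ) : Measure (Cols p n) :=
  Measure.pi fun _ => multivariateGaussian 0 S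

instance {p n : ℕ} (S : Matrix (Fin p) (Fin p) ℝ) : IsProbabilityMeasure (noiseLaw n S) := by
  unfold noiseLaw; infer_instance

instance {p n : ℕ} (S : Matrix (Fin p) (Fin p) ℝ) (θ : Cols p n) :
    IsProbabilityMeasure (dataLaw S θ) := by
  unfold dataLaw; infer_instance

lemma multivariateGaussian_map_sub {p : ℕ} (S : Matrix (Fin p) (Fin p) ℝ)
    (μ : EuclideanSpace ℝ (Fin p)) :
    (multivariateGaussian μ S).map (fun x => x - μ) = multivariateGaussian 0 S := by
  rw [multivariateGaussian, multivariateGaussian, Measure.map_map (by fun_prop) (by fun_prop)]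
  congr 1
  ext1 x
  simp

lemma dataLaw_map_sub {p n : ℕ} (S : Matrix (Fin p) (Fin p) ℝ) (θ : Cols p n) :
    (dataLaw S θ).map (fun X => X - θ) = noiseLaw n S := by
  have h := Measure.pi_map_pi (μ := fun t => multivariateGaussian (θ t) S)
    (f := fun t x => x - θ t) (fun t => by fun_prop)
  simp_rw [multivariateGaussian_map_sub] at h
  exact h

/-- Only an inequality is claimed, so that `B` may be any set: no event below has to be shown
measurable. -/
lemma dataLaw_preimage_le {p n : ℕ} (S : Matrix (Fin p) (Fin p) ℝ) (θ : Cols p n)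
    (B : Set (Cols p n)) : dataLaw S θ {X | X - θ ∈ B} ≤ noiseLaw n S B := by
  rw [← dataLaw_map_sub S θ]
  exact Measure.le_map_apply (by fun_prop) B

/-! ### Variance of sums of i.i.d. variables -/

section IIDSums

variable {E : Type*} [MeasurableSpace E] {n : ℕ} (ν : Measure E) [IsProbabilityMeasure ν]

lemma memLp_sum_pi {f : E → ℝ} (hf : MemLp f 2 ν) (D : Finset (Fin n)) :
    MemLp (fun W : Fin n → E => ∑ t ∈ D, f (W t)) 2 (Measure.pi fun _ => ν) :=
  memLp_finsetSum D fun t _ => hf.comp_measurePreserving (measurePreserving_eval (fun _ => ν) t)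

/-- The variance of a sum of i.i.d. square integrable random variables. -/
lemma integral_sq_sum_sub_pi {f : E → ℝ} (hf : MemLp f 2 ν) (D : Finset (Fin n)) :
    ∫ W : Fin n → E, (∑ t ∈ D, f (W t) - (D.card : ℝ) * ∫ x, f x ∂ν) ^ 2 ∂(Measure.pi fun _ => ν)
      = (D.card : ℝ) * Var[f; ν] := by
  have hL : ∀ t : Fin n, MemLp (fun W : Fin n → E => f (W t)) 2 (Measure.pi fun _ => ν) :=
    fun t => hf.comp_measurePreserving (measurePreserving_eval (fun _ => ν) t)
  have hE : ∀ t : Fin n, ∫ W : Fin n → E, f (W t) ∂(Measure.pi fun _ => ν) = ∫ x, f x ∂ν :=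
    fun t => integral_comp_eval (μ := fun _ : Fin n => ν) hf.aestronglyMeasurable
  have hV : ∀ t : Fin n, Var[fun W : Fin n → E => f (W t); Measure.pi fun _ => ν] = Var[f; ν] := by
    intro t
    rw [variance_eq_integral (hL t).aemeasurable, variance_eq_integral hf.aemeasurable, hE t]
    exact integral_comp_eval (μ := fun _ : Fin n => ν) (f := fun x => (f x - ∫ x, f x ∂ν) ^ 2)
      (by have := hf.aestronglyMeasurable; fun_prop)
  have h := IndepFun.variance_sum (μ := Measure.pi fun _ : Fin n => ν) (s := D)
    (X := fun t W => f (W t)) (fun t _ => hL t)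
    (fun i _ j _ hij => (iIndepFun_pi (μ := fun _ : Fin n => ν) (X := fun _ => f)
      fun i => hf.aemeasurable).indepFun hij)
  simp_rw [hV] at h
  rw [Finset.sum_const, nsmul_eq_mul] at h
  rw [← h, variance_eq_integral (Finset.aemeasurable_sum _ fun t _ => (hL t).aemeasurable)]
  have hm : ∫ W : Fin n → E, (∑ t ∈ D, fun W : Fin n → E => f (W t)) W ∂(Measure.pi fun _ => ν)
      = (D.card : ℝ) * ∫ x, f x ∂ν := by
    simp_rw [Finset.sum_apply]
    rw [integral_finsetSum _ fun t _ => (hL t).integrable (by norm_num)]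
    simp_rw [hE]
    simp
  rw [hm]
  simp_rw [Finset.sum_apply]

lemma integral_sq_sum_sub_pi_le {f : E → ℝ} (hf : MemLp f 2 ν) (D : Finset (Fin n)) :
    ∫ W : Fin n → E, (∑ t ∈ D, f (W t) - (D.card : ℝ) * ∫ x, f x ∂ν) ^ 2 ∂(Measure.pi fun _ => ν)
      ≤ (D.card : ℝ) * ∫ x, f x ^ 2 ∂ν := by
  rw [integral_sq_sum_sub_pi ν hf]
  gcongr
  simpa using variance_le_expectation_sq hf.aestronglyMeasurable

lemma integrable_sq_sum_sub_pi {f : E → ℝ} (hf : MemLp f 2 ν) (D : Finset (Fin n)) (a : ℝ) :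
    Integrable (fun W : Fin n → E => (∑ t ∈ D, f (W t) - a) ^ 2) (Measure.pi fun _ => ν) :=
  ((memLp_sum_pi ν hf D).sub (memLp_const a)).integrable_sq

end IIDSums

/-! ### Gaussian moments up to order four -/

section Moments

/-- The fourth moment of the standard Gaussian. -/
noncomputable def gaussianFourthMoment : ℝ := ∫ x, x ^ 4 ∂(gaussianReal 0 1)

lemma gaussianFourthMoment_nonneg : 0 ≤ gaussianFourthMoment :=
  integral_nonneg fun x => by positivity

lemma gaussianReal_eq_map_sqrt {v : ℝ} (hv : 0 ≤ v) :
    gaussianReal 0 v.toNNReal = (gaussianReal 0 1).map (Real.sqrt v * ·) := by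
  rw [gaussianReal_map_const_mul]
  congr 1
  · simp
  · ext
    simp [Real.sq_sqrt hv, hv]

lemma integral_pow_four_gaussianReal {v : ℝ} (hv : 0 ≤ v) :
    ∫ x, x ^ 4 ∂(gaussianReal 0 v.toNNReal) = gaussianFourthMoment * v ^ 2 := by
  rw [gaussianReal_eq_map_sqrt hv, integral_map (by fun_prop) (by fun_prop)]
  simp_rw [mul_pow]
  rw [integral_const_mul, gaussianFourthMoment,
    show Real.sqrt v ^ 4 = (Real.sqrt v ^ 2) ^ 2 by ring, Real.sq_sqrt hv, mul_comm]

variable {p : ℕ} {S : Matrix (Fin p) (Fin p) ℝ}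

lemma integrable_coord_pow_four (hS : S.PosSemidef) (i : Fin p) :
    Integrable (fun x : EuclideanSpace ℝ (Fin p) => x i ^ 4) (multivariateGaussian 0 S) := by
  have h := measurePreserving_eval_multivariateGaussian (μ := 0) hS (i := i)
  have h4 : MemLp id 4 (gaussianReal ((0 : EuclideanSpace ℝ (Fin p)) i) (S i i).toNNReal) :=
    memLp_id_gaussianReal 4
  have h' := (h4.integrable_norm_pow (by norm_num))
  have := h.integrable_comp_of_integrable h'
  refine this.congr (Filter.Eventually.of_forall fun x => ?_)
  simp only [Function.comp, id, Real.norm_eq_abs]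
  exact Even.pow_abs ⟨2, rfl⟩ _

lemma integral_coord_pow_four (hS : S.PosSemidef) (i : Fin p) :
    ∫ x : EuclideanSpace ℝ (Fin p), x i ^ 4 ∂(multivariateGaussian 0 S)
      = gaussianFourthMoment * S i i ^ 2 := by
  have h := measurePreserving_eval_multivariateGaussian (μ := 0) hS (i := i)
  rw [← integral_pow_four_gaussianReal hS.diag_nonneg]
  rw [show (0 : ℝ) = (0 : EuclideanSpace ℝ (Fin p)) i from rfl, ← h.map_eq,
    integral_map (by fun_prop) (by fun_prop)]

/-- Weighted AM-GM, replacing Cauchy–Schwarz. With `a = S i i` and `b = S j j` both terms on the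
right have the same Gaussian expectation, so nothing is lost. -/
lemma sq_mul_sq_le {a b : ℝ} (ha : 0 < a) (hb : 0 < b) (x y : ℝ) :
    (x * y) ^ 2 ≤ (b / (2 * a)) * x ^ 4 + (a / (2 * b)) * y ^ 4 := by
  have : (b / (2 * a)) * x ^ 4 + (a / (2 * b)) * y ^ 4 - (x * y) ^ 2
      = (b * x ^ 2 - a * y ^ 2) ^ 2 / (2 * a * b) := by field_simp; ring
  have h2 : 0 ≤ (b * x ^ 2 - a * y ^ 2) ^ 2 / (2 * a * b) := by positivity
  linarith

lemma integrable_coord_mul_sq (hS : S.PosDef) (i j : Fin p) :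
    Integrable (fun x : EuclideanSpace ℝ (Fin p) => (x i * x j) ^ 2)
      (multivariateGaussian 0 S) := by
  refine (((integrable_coord_pow_four hS.posSemidef i).const_mul (S j j / (2 * S i i))).add
    ((integrable_coord_pow_four hS.posSemidef j).const_mul (S i i / (2 * S j j)))).mono'
    (by fun_prop) (Filter.Eventually.of_forall fun x => ?_)
  rw [Real.norm_eq_abs, abs_of_nonneg (sq_nonneg _)]
  exact sq_mul_sq_le hS.diag_pos hS.diag_pos _ _

lemma integral_coord_mul_sq_le (hS : S.PosDef) (i j : Fin p) :
    ∫ x : EuclideanSpace ℝ (Fin p), (x i * x j) ^ 2 ∂(multivariateGaussian 0 S)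
      ≤ gaussianFourthMoment * (S i i * S j j) := by
  have hi := integrable_coord_pow_four hS.posSemidef i
  have hj := integrable_coord_pow_four hS.posSemidef j
  have hii : 0 < S i i := hS.diag_pos
  have hjj : 0 < S j j := hS.diag_pos
  calc _ ≤ ∫ x : EuclideanSpace ℝ (Fin p), ((S j j / (2 * S i i)) * x i ^ 4
          + (S i i / (2 * S j j)) * x j ^ 4) ∂(multivariateGaussian 0 S) :=
        integral_mono (integrable_coord_mul_sq hS i j)
          ((hi.const_mul _).add (hj.const_mul _)) fun x => sq_mul_sq_le hii hjj _ _
    _ = _ := by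
        rw [integral_add (hi.const_mul _) (hj.const_mul _), integral_const_mul, integral_const_mul,
          integral_coord_pow_four hS.posSemidef, integral_coord_pow_four hS.posSemidef]
        field_simp
        ring

lemma memLp_coord (i : Fin p) :
    MemLp (fun x : EuclideanSpace ℝ (Fin p) => x i) 2 (multivariateGaussian 0 S) :=
  (IsGaussian.memLp_dual (multivariateGaussian 0 S) (EuclideanSpace.proj i) 2 (by norm_num))

lemma integral_coord (i : Fin p) :
    ∫ x : EuclideanSpace ℝ (Fin p), x i ∂(multivariateGaussian 0 S) = 0 := by
  have := (EuclideanSpace.proj (𝕜 := ℝ) i).integral_comp_id_comm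
    (μ := multivariateGaussian 0 S) IsGaussian.integrable_id
  simpa using this

lemma integral_coord_mul (hS : S.PosSemidef) (i j : Fin p) :
    ∫ x : EuclideanSpace ℝ (Fin p), x i * x j ∂(multivariateGaussian 0 S) = S i j := by
  rw [← covariance_eval_multivariateGaussian (μ := 0) hS i j, covariance]
  simp_rw [integral_coord, sub_zero]

lemma memLp_coord_mul (hS : S.PosDef) (i j : Fin p) :
    MemLp (fun x : EuclideanSpace ℝ (Fin p) => x i * x j) 2 (multivariateGaussian 0 S) :=
  (memLp_two_iff_integrable_sq (by fun_prop)).2 (integrable_coord_mul_sq hS i j)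

lemma memLp_sum_coord_sq (hS : S.PosDef) :
    MemLp (fun x : EuclideanSpace ℝ (Fin p) => ∑ i, x i * x i) 2 (multivariateGaussian 0 S) :=
  memLp_finsetSum _ fun i _ => memLp_coord_mul hS i i

lemma integral_sum_coord_sq (hS : S.PosDef) :
    ∫ x : EuclideanSpace ℝ (Fin p), ∑ i, x i * x i ∂(multivariateGaussian 0 S) = S.trace := by
  rw [integral_finsetSum _ fun i _ => (memLp_coord_mul hS i i).integrable (by norm_num)]
  simp_rw [integral_coord_mul hS.posSemidef]
  rfl

lemma integral_sq_sum_coord_sq_le (hS : S.PosDef) :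
    ∫ x : EuclideanSpace ℝ (Fin p), (∑ i, x i * x i) ^ 2 ∂(multivariateGaussian 0 S)
      ≤ gaussianFourthMoment * S.trace ^ 2 := by
  have h : ∀ x : EuclideanSpace ℝ (Fin p),
      (∑ i, x i * x i) ^ 2 = ∑ i, ∑ j, (x i * x j) ^ 2 := by
    intro x
    rw [sq, Finset.sum_mul_sum]
    exact Finset.sum_congr rfl fun i _ => Finset.sum_congr rfl fun j _ => by ring
  simp_rw [h]
  rw [integral_finsetSum _ fun i _ => integrable_finsetSum _ fun j _ =>
    integrable_coord_mul_sq hS i j]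
  simp_rw [integral_finsetSum _ fun j _ => integrable_coord_mul_sq hS _ j]
  calc _ ≤ ∑ i, ∑ j, gaussianFourthMoment * (S i i * S j j) :=
        Finset.sum_le_sum fun i _ => Finset.sum_le_sum fun j _ => integral_coord_mul_sq_le hS i j
    _ = _ := by
        simp_rw [← Finset.mul_sum, ← Finset.sum_mul, sq]
        rfl

end Moments

/-! ### Exponential moments of a centred chi-square variable -/

section ChiSquare

/-- The left side is the moment generating function of a centred chi-square variable with one degree
of freedom. After squaring, the claim follows from `(1 + 2l + 8l²)(1 - 2l) = 1 + 4l²(1 - 4l) ≥ 1`.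
-/
lemma exp_neg_div_sqrt_le {l : ℝ} (hl : |l| ≤ 1 / 4) :
    Real.exp (-l) / Real.sqrt (1 - 2 * l) ≤ Real.exp (4 * l ^ 2) := by
  obtain ⟨h1, h2⟩ := abs_le.1 hl
  have h0 : 0 < 1 - 2 * l := by linarith
  rw [div_le_iff₀ (Real.sqrt_pos.2 h0)]
  have key : Real.exp (-(l + 4 * l ^ 2)) ≤ Real.sqrt (1 - 2 * l) := by
    apply Real.le_sqrt_of_sq_le
    rw [← Real.exp_nat_mul, show ((2 : ℕ) : ℝ) * -(l + 4 * l ^ 2) = -(2 * l + 8 * l ^ 2) by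
      push_cast; ring, Real.exp_neg, inv_le_comm₀ (Real.exp_pos _) h0]
    refine le_trans ?_ (Real.add_one_le_exp _)
    rw [inv_le_iff_one_le_mul₀ h0]
    nlinarith [mul_nonneg (sq_nonneg l) (show 0 ≤ 1 - 4 * l by linarith)]
  calc Real.exp (-l) = Real.exp (4 * l ^ 2) * Real.exp (-(l + 4 * l ^ 2)) := by
        rw [← Real.exp_add]; ring_nf
    _ ≤ _ := by gcongr

lemma lintegral_exp_sq_sub_one_le {l : ℝ} (hl : |l| ≤ 1 / 4) :
    ∫⁻ x, ENNReal.ofReal (Real.exp (l * (x ^ 2 - 1))) ∂(gaussianReal 0 1)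
      ≤ ENNReal.ofReal (Real.exp (4 * l ^ 2)) := by
  obtain ⟨h1, h2⟩ := abs_le.1 hl
  have hb : 0 < 1 / 2 - l := by linarith
  rw [gaussianReal_of_var_ne_zero _ one_ne_zero,
    lintegral_withDensity_eq_lintegral_mul _ (measurable_gaussianPDF 0 1) (by fun_prop)]
  have h : ∀ x : ℝ, (gaussianPDF 0 1 * fun x => ENNReal.ofReal (Real.exp (l * (x ^ 2 - 1)))) x
      = ENNReal.ofReal ((Real.sqrt (2 * Real.pi))⁻¹ * Real.exp (-l)
        * Real.exp (-(1 / 2 - l) * x ^ 2)) := by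
    intro x
    rw [Pi.mul_apply, gaussianPDF, ← ENNReal.ofReal_mul (gaussianPDFReal_nonneg _ _ _),
      gaussianPDFReal]
    congr 1
    simp only [NNReal.coe_one, mul_one, sub_zero]
    rw [mul_assoc, ← Real.exp_add, mul_assoc, ← Real.exp_add]
    ring_nf
  simp_rw [h]
  rw [← ofReal_integral_eq_lintegral_ofReal ((integrable_exp_neg_mul_sq hb).const_mul _)
    (Filter.Eventually.of_forall fun x => by positivity), integral_const_mul, integral_gaussian]
  apply ENNReal.ofReal_le_ofReal
  refine le_trans (le_of_eq ?_) (exp_neg_div_sqrt_le hl)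
  rw [show Real.pi / (1 / 2 - l) = 2 * Real.pi / (1 - 2 * l) by field_simp,
    Real.sqrt_div (by positivity)]
  have : Real.sqrt (2 * Real.pi) ≠ 0 := by positivity
  field_simp

lemma lintegral_exp_sq_sub_le {v l : ℝ} (hv : 0 ≤ v) (hl : |l| * v ≤ 1 / 4) :
    ∫⁻ x, ENNReal.ofReal (Real.exp (l * (x ^ 2 - v))) ∂(gaussianReal 0 v.toNNReal)
      ≤ ENNReal.ofReal (Real.exp (4 * l ^ 2 * v ^ 2)) := by
  rw [gaussianReal_eq_map_sqrt hv, lintegral_map (by fun_prop) (by fun_prop)]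
  simp_rw [mul_pow, Real.sq_sqrt hv]
  have := lintegral_exp_sq_sub_one_le (l := l * v) (by rwa [abs_mul, abs_of_nonneg hv])
  refine le_of_eq_of_le (lintegral_congr fun x => ?_) (this.trans_eq ?_)
  · congr 2
    ring
  · congr 2
    ring

end ChiSquare

/-! ### Exponential moments of the quadratic form in a fixed direction -/

section QuadraticForm

variable {p : ℕ} {S : Matrix (Fin p) (Fin p) ℝ}

/-- The quadratic form `w ↦ wᵀ A w`. -/
noncomputable def quadForm (A : Matrix (Fin p) (Fin p) ℝ) (w : EuclideanSpace ℝ (Fin p)) : ℝ :=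
  ⟪w, Matrix.toEuclideanCLM (n := Fin p) (𝕜 := ℝ) A w⟫

lemma quadForm_nonneg (hS : S.PosSemidef) (w : EuclideanSpace ℝ (Fin p)) : 0 ≤ quadForm S w := by
  rw [quadForm, Matrix.inner_toEuclideanCLM]
  simpa using hS.dotProduct_mulVec_nonneg w.ofLp

lemma quadForm_le (A : Matrix (Fin p) (Fin p) ℝ) (w : EuclideanSpace ℝ (Fin p)) :
    quadForm A w ≤ opNorm A * ‖w‖ ^ 2 := by
  calc quadForm A w ≤ ‖w‖ * ‖Matrix.toEuclideanCLM (n := Fin p) (𝕜 := ℝ) A w‖ :=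
        real_inner_le_norm _ _
    _ ≤ ‖w‖ * (opNorm A * ‖w‖) := by
        gcongr
        exact ContinuousLinearMap.le_opNorm _ _
    _ = _ := by ring

lemma multivariateGaussian_map_inner (hS : S.PosSemidef) (w : EuclideanSpace ℝ (Fin p)) :
    (multivariateGaussian 0 S).map (fun x => ⟪w, x⟫) = gaussianReal 0 (quadForm S w).toNNReal := by
  have h := IsGaussian.map_eq_gaussianReal (μ := multivariateGaussian 0 S) (innerSL ℝ w)
  have hm : ∫ x, innerSL ℝ w x ∂(multivariateGaussian 0 S) = 0 := by
    have := (innerSL ℝ w).integral_comp_id_comm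
      (μ := multivariateGaussian 0 S) IsGaussian.integrable_id
    simpa using this
  have hv : Var[innerSL ℝ w; multivariateGaussian 0 S] = quadForm S w := by
    rw [quadForm, Matrix.inner_toEuclideanCLM, ← covarianceBilin_multivariateGaussian (μ := 0) hS,
      covarianceBilin_apply_eq_cov IsGaussian.memLp_two_id, covariance_self (by fun_prop)]
    rfl
  rw [hm, hv] at h
  exact h

/-- The centred, unnormalised second moment matrix `∑ W_t W_tᵀ - |D| Σ`. -/
noncomputable def centredSum {n : ℕ} (S : Matrix (Fin p) (Fin p) ℝ) (D : Finset (Fin n))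
    (W : Cols p n) : Matrix (Fin p) (Fin p) ℝ :=
  ∑ t ∈ D, Matrix.vecMulVec (W t).ofLp (W t).ofLp - (D.card : ℝ) • S

lemma centredSum_apply {n : ℕ} (D : Finset (Fin n)) (W : Cols p n) (i j : Fin p) :
    centredSum S D W i j = ∑ t ∈ D, W t i * W t j - (D.card : ℝ) * S i j := by
  simp [centredSum, Matrix.sum_apply, Matrix.vecMulVec_apply]

lemma quadForm_centredSum {n : ℕ} (D : Finset (Fin n)) (W : Cols p n)
    (w : EuclideanSpace ℝ (Fin p)) :
    quadForm (centredSum S D W) w = ∑ t ∈ D, (⟪w, W t⟫ ^ 2 - quadForm S w) := by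
  rw [Finset.sum_sub_distrib, Finset.sum_const, nsmul_eq_mul]
  simp only [quadForm, Matrix.inner_toEuclideanCLM, centredSum, Matrix.sub_mulVec,
    Matrix.smul_mulVec, Matrix.sum_mulVec, dotProduct_sub, dotProduct_smul, smul_eq_mul,
    dotProduct_sum]
  congr 1
  refine Finset.sum_congr rfl fun t _ => ?_
  rw [Matrix.vecMulVec_mulVec]
  simp only [EuclideanSpace.inner_eq_star_dotProduct, star_trivial]
  simp [sq, dotProduct_comm]

lemma centredSum_isHermitian {n : ℕ} (hS : S.IsHermitian) (D : Finset (Fin n)) (W : Cols p n) :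
    (centredSum S D W).IsHermitian := by
  ext i j
  rw [Matrix.conjTranspose_apply, centredSum_apply, centredSum_apply, star_trivial]
  have : S j i = S i j := by simpa using hS.apply i j
  rw [this]
  simp_rw [mul_comm]

/-- The variables `⟪w, W_t⟫` are independent centred Gaussians of variance `quadForm S w`, so the
exponential moment factors into chi-square ones. -/
lemma lintegral_exp_quadForm_centredSum_le {n : ℕ} (hS : S.PosSemidef) (D : Finset (Fin n)) {l : ℝ}
    {w : EuclideanSpace ℝ (Fin p)} (hl : |l| * quadForm S w ≤ 1 / 4) :
    ∫⁻ W, ENNReal.ofReal (Real.exp (l * quadForm (centredSum S D W) w)) ∂(noiseLaw n S)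
      ≤ ENNReal.ofReal (Real.exp (4 * l ^ 2 * quadForm S w ^ 2 * D.card)) := by
  simp_rw [quadForm_centredSum, Finset.mul_sum, Real.exp_sum]
  simp_rw [ENNReal.ofReal_prod_of_nonneg fun _ _ => (Real.exp_pos _).le]
  have hind := iIndepFun_pi (μ := fun _ : Fin n => multivariateGaussian 0 S)
    (X := fun _ x => ENNReal.ofReal (Real.exp (l * (⟪w, x⟫ ^ 2 - quadForm S w))))
    (fun _ => by fun_prop)
  have hprod := lintegral_prod_eq_prod_lintegral_of_indepFun D _ hind (fun t => by fun_prop)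
  unfold noiseLaw
  rw [hprod]
  have hone : ∀ t : Fin n, ∫⁻ W : Cols p n,
      ENNReal.ofReal (Real.exp (l * (⟪w, W t⟫ ^ 2 - quadForm S w)))
        ∂(Measure.pi fun _ => multivariateGaussian 0 S)
      ≤ ENNReal.ofReal (Real.exp (4 * l ^ 2 * quadForm S w ^ 2)) := by
    intro t
    have h1 := (measurePreserving_eval (fun _ : Fin n => multivariateGaussian 0 S) t).lintegral_comp
      (f := fun x => ENNReal.ofReal (Real.exp (l * (⟪w, x⟫ ^ 2 - quadForm S w)))) (by fun_prop)
    rw [h1]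
    have h2 := lintegral_exp_sq_sub_le (quadForm_nonneg hS w) hl
    rw [← multivariateGaussian_map_inner hS w, lintegral_map (by fun_prop) (by fun_prop)] at h2
    exact h2
  calc _ ≤ ∏ _t ∈ D, ENNReal.ofReal (Real.exp (4 * l ^ 2 * quadForm S w ^ 2)) :=
        Finset.prod_le_prod' fun t _ => hone t
    _ = _ := by
        rw [Finset.prod_const, ← ENNReal.ofReal_pow (Real.exp_pos _).le, ← Real.exp_nat_mul]
        congr 2
        ring

end QuadraticForm

/-! ### Operator norm tail by integration over a ball -/

section OpNorm

variable {p : ℕ} {S : Matrix (Fin p) (Fin p) ℝ}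

/-- Near an approximate maximiser of the quadratic form of a symmetric matrix, the quadratic form
is at least half the operator norm. -/
lemma exists_half_opNorm_le_abs_quadForm {A : Matrix (Fin p) (Fin p) ℝ} (hA : A.IsHermitian)
    (hpos : 0 < opNorm A) :
    ∃ v : EuclideanSpace ℝ (Fin p), ‖v‖ = 1 ∧
      ∀ w ∈ Metric.ball v (1 / 8), opNorm A / 2 ≤ |quadForm A w| := by
  set T := Matrix.toEuclideanCLM (n := Fin p) (𝕜 := ℝ) A with hT
  have hsym : (T : EuclideanSpace ℝ (Fin p) →ₗ[ℝ] EuclideanSpace ℝ (Fin p)).IsSymmetric := by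
    have : IsSelfAdjoint T := IsSelfAdjoint.map hA.isSelfAdjoint _
    exact this.isSymmetric
  have hnorm : ‖T‖ = opNorm A := rfl
  -- The factor `9 / 10` leaves room for the variation over the ball: `9/10 - 9/64 - 1/8 > 1/2`.
  have hlt : 9 / 10 * ‖T‖ < ⨆ x, |T.rayleighQuotient x| := by
    rw [← T.norm_eq_iSup_rayleighQuotient hsym, hnorm]
    linarith
  obtain ⟨x, hx⟩ := exists_lt_of_lt_ciSup hlt
  have hx0 : x ≠ 0 := by
    rintro rfl
    rw [T.rayleighQuotient_apply_zero, abs_zero, hnorm] at hx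
    linarith
  have hxn : 0 < ‖x‖ := norm_pos_iff.2 hx0
  refine ⟨‖x‖⁻¹ • x, by rw [norm_smul, norm_inv, norm_norm, inv_mul_cancel₀ hxn.ne'], ?_⟩
  rw [← T.rayleigh_smul x (inv_ne_zero hxn.ne')] at hx
  set v : EuclideanSpace ℝ (Fin p) := ‖x‖⁻¹ • x with hv
  have hvn : ‖v‖ = 1 := by rw [hv, norm_smul, norm_inv, norm_norm, inv_mul_cancel₀ hxn.ne']
  have hvq : 9 / 10 * opNorm A < |quadForm A v| := by
    have h1 : T.rayleighQuotient v = quadForm A v := by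
      rw [ContinuousLinearMap.rayleighQuotient, ContinuousLinearMap.reApplyInnerSelf_apply, hvn,
        quadForm, real_inner_comm]
      simp [hT]
    rw [← h1]
    exact hx
  intro w hw
  have hwv : ‖w - v‖ ≤ 1 / 8 := by
    rw [← dist_eq_norm]; exact (Metric.mem_ball.1 hw).le
  have hwn : ‖w‖ ≤ 9 / 8 := by
    calc ‖w‖ = ‖(w - v) + v‖ := by rw [sub_add_cancel]
      _ ≤ ‖w - v‖ + ‖v‖ := norm_add_le _ _
      _ ≤ _ := by rw [hvn]; linarith
  have hdiff : quadForm A w - quadForm A v = ⟪w, T (w - v)⟫ + ⟪w - v, T v⟫ := by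
    simp only [quadForm, ← hT, map_sub, inner_sub_left, inner_sub_right]
    ring
  have hb1 : |⟪w, T (w - v)⟫| ≤ 9 / 8 * (opNorm A * (1 / 8)) := by
    refine (abs_real_inner_le_norm _ _).trans ?_
    gcongr
    exact (T.le_opNorm _).trans (by rw [hnorm]; gcongr)
  have hb2 : |⟪w - v, T v⟫| ≤ 1 / 8 * (opNorm A * 1) := by
    refine (abs_real_inner_le_norm _ _).trans ?_
    gcongr
    exact (T.le_opNorm _).trans (by rw [hnorm, hvn])
  have h3 : |quadForm A v| ≤ |quadForm A w| + |quadForm A w - quadForm A v| := by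
    have := abs_sub_abs_le_abs_sub (quadForm A v) (quadForm A w)
    rw [abs_sub_comm] at this
    linarith
  have h4 : |quadForm A w - quadForm A v| ≤ 9 / 8 * (opNorm A * (1 / 8)) + 1 / 8 * (opNorm A * 1) := by
    rw [hdiff]
    exact (abs_add_le _ _).trans (add_le_add hb1 hb2)
  linarith

/-- An integral form of the net argument: the exponential integral of the quadratic form over a
ball controls the operator norm. -/
lemma volume_mul_exp_le_lintegral_quadForm {A : Matrix (Fin p) (Fin p) ℝ} (hA : A.IsHermitian)
    {l τ : ℝ} (hl : 0 ≤ l) (hτ : 0 < τ) (h : τ ≤ opNorm A) :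
    volume (Metric.ball (0 : EuclideanSpace ℝ (Fin p)) (1 / 8))
        * ENNReal.ofReal (Real.exp (l * τ / 2))
      ≤ ∫⁻ w in Metric.ball (0 : EuclideanSpace ℝ (Fin p)) 2,
        (ENNReal.ofReal (Real.exp (l * quadForm A w))
          + ENNReal.ofReal (Real.exp (-l * quadForm A w))) := by
  obtain ⟨v, hv, hvw⟩ := exists_half_opNorm_le_abs_quadForm hA (hτ.trans_le h)
  have hsub : Metric.ball v (1 / 8) ⊆ Metric.ball (0 : EuclideanSpace ℝ (Fin p)) 2 := by
    apply Metric.ball_subset_ball'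
    rw [dist_zero_right, hv]
    norm_num
  -- The maximiser `v` depends on the matrix, but by translation invariance the volume of its ball
  -- does not.
  calc _ = ∫⁻ _ in Metric.ball v (1 / 8), ENNReal.ofReal (Real.exp (l * τ / 2)) := by
        rw [setLIntegral_const, Measure.addHaar_ball_center volume v, mul_comm]
    _ ≤ ∫⁻ w in Metric.ball v (1 / 8), (ENNReal.ofReal (Real.exp (l * quadForm A w))
          + ENNReal.ofReal (Real.exp (-l * quadForm A w))) := by
        refine setLIntegral_mono' Metric.isOpen_ball.measurableSet fun w hw => ?_
        have h2 : τ / 2 ≤ |quadForm A w| := by linarith [hvw w hw]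
        rcases le_abs.1 h2 with h3 | h3
        · refine le_trans (ENNReal.ofReal_le_ofReal (Real.exp_le_exp.2 ?_)) le_self_add
          nlinarith
        · refine le_trans (ENNReal.ofReal_le_ofReal (Real.exp_le_exp.2 ?_)) le_add_self
          nlinarith
    _ ≤ _ := lintegral_mono_set hsub

lemma measurable_exp_quadForm_centredSum {n : ℕ} (D : Finset (Fin n)) (l : ℝ) :
    Measurable fun z : Cols p n × EuclideanSpace ℝ (Fin p) =>
      ENNReal.ofReal (Real.exp (l * quadForm (centredSum S D z.1) z.2)) := by
  simp_rw [quadForm_centredSum, quadForm]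
  fun_prop

/-- Markov's inequality for the exponential integral over the ball of radius `2`, computed by
Tonelli. The factor `16 ^ p` is the volume ratio of the balls of radii `2` and `1 / 8`, the `2`
counts both signs of the form, and `64 = 4 * 4 ^ 2` since `quadForm S w ≤ 4 * opNorm S` on the large
ball. -/
lemma noiseLaw_opNorm_centredSum_le {n : ℕ} (hS : S.PosSemidef) (D : Finset (Fin n)) {l τ : ℝ}
    (hl : 0 ≤ l) (hτ : 0 < τ) (hls : l * (opNorm S * 4) ≤ 1 / 4) :
    noiseLaw n S {W | τ ≤ opNorm (centredSum S D W)}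
      ≤ ENNReal.ofReal (2 * 16 ^ p
        * Real.exp (64 * (l * opNorm S) ^ 2 * D.card - l * τ / 2)) := by
  set V : ℝ≥0∞ := volume (Metric.ball (0 : EuclideanSpace ℝ (Fin p)) (1 / 8)) with hVdef
  have hV0 : V ≠ 0 := (Metric.measure_ball_pos _ _ (by norm_num)).ne'
  have hVtop : V ≠ ⊤ := measure_ball_lt_top.ne
  have hV2 : volume (Metric.ball (0 : EuclideanSpace ℝ (Fin p)) 2) = ENNReal.ofReal (16 ^ p) * V := by
    have := Measure.addHaar_ball_mul_of_pos (volume : Measure (EuclideanSpace ℝ (Fin p))) 0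
      (r := 16) (by norm_num) (1 / 8)
    rw [finrank_euclideanSpace, Fintype.card_fin] at this
    rw [← this]
    norm_num
  set M : ℝ := Real.exp (64 * (l * opNorm S) ^ 2 * D.card) with hM
  have hs0 : 0 ≤ opNorm S := norm_nonneg _
  have hq : ∀ w ∈ Metric.ball (0 : EuclideanSpace ℝ (Fin p)) 2, quadForm S w ≤ opNorm S * 4 := by
    intro w hw
    have hw2 : ‖w‖ < 2 := by simpa using hw
    refine (quadForm_le S w).trans ?_
    gcongr
    nlinarith [norm_nonneg w]
  have hbound : ∀ l' : ℝ, |l'| = l → ∀ w ∈ Metric.ball (0 : EuclideanSpace ℝ (Fin p)) 2,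
      ∫⁻ W, ENNReal.ofReal (Real.exp (l' * quadForm (centredSum S D W) w)) ∂(noiseLaw n S)
        ≤ ENNReal.ofReal M := by
    intro l' hl' w hw
    have hq0 := quadForm_nonneg hS w
    have hqw := hq w hw
    refine (lintegral_exp_quadForm_centredSum_le hS D (l := l') ?_).trans ?_
    · rw [hl']
      exact le_trans (by gcongr) hls
    · apply ENNReal.ofReal_le_ofReal
      rw [hM]
      apply Real.exp_le_exp.2
      have : l' ^ 2 = l ^ 2 := by rw [← hl', sq_abs]
      rw [this]
      calc 4 * l ^ 2 * quadForm S w ^ 2 * D.card ≤ 4 * l ^ 2 * (opNorm S * 4) ^ 2 * D.card := by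
            gcongr
        _ = _ := by ring
  set F : Cols p n → ℝ≥0∞ := fun W => ∫⁻ w in Metric.ball (0 : EuclideanSpace ℝ (Fin p)) 2,
        (ENNReal.ofReal (Real.exp (l * quadForm (centredSum S D W) w))
          + ENNReal.ofReal (Real.exp (-l * quadForm (centredSum S D W) w))) with hF
  have hm1 := measurable_exp_quadForm_centredSum (S := S) D l
  have hm2 := measurable_exp_quadForm_centredSum (S := S) D (-l)
  have hFm : Measurable F := (hm1.add hm2).lintegral_prod_right'
  have hFint : ∫⁻ W, F W ∂(noiseLaw n S) ≤ 2 * ENNReal.ofReal M * (ENNReal.ofReal (16 ^ p) * V) := by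
    rw [hF, lintegral_lintegral_swap (hm1.add hm2).aemeasurable, ← hV2, ← setLIntegral_const]
    refine setLIntegral_mono' Metric.isOpen_ball.measurableSet fun w hw => ?_
    have hm : Measurable fun W : Cols p n =>
        ENNReal.ofReal (Real.exp (l * quadForm (centredSum S D W) w)) :=
      Measurable.of_uncurry_right (f := fun W w =>
        ENNReal.ofReal (Real.exp (l * quadForm (centredSum S D W) w))) hm1
    have hp := hbound l (abs_of_nonneg hl) w hw
    have hn := hbound (-l) (by rw [abs_neg, abs_of_nonneg hl]) w hw
    rw [lintegral_add_left hm, two_mul]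
    exact add_le_add hp hn
  have hmarkov := mul_meas_ge_le_lintegral (μ := noiseLaw n S) hFm
    (V * ENNReal.ofReal (Real.exp (l * τ / 2)))
  have hsub : {W | τ ≤ opNorm (centredSum S D W)}
      ⊆ {W | V * ENNReal.ofReal (Real.exp (l * τ / 2)) ≤ F W} := fun W hW =>
    volume_mul_exp_le_lintegral_quadForm (centredSum_isHermitian hS.isHermitian D W) hl hτ hW
  set P := noiseLaw n S {W | τ ≤ opNorm (centredSum S D W)} with hP
  have h1 : V * (ENNReal.ofReal (Real.exp (l * τ / 2)) * P)
      ≤ V * (ENNReal.ofReal (2 * 16 ^ p * M)) := by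
    calc _ = V * ENNReal.ofReal (Real.exp (l * τ / 2)) * P := by ring
      _ ≤ _ := by gcongr; exact measure_mono hsub
      _ ≤ _ := hmarkov
      _ ≤ _ := hFint
      _ = _ := by
        rw [ENNReal.ofReal_mul (by positivity), ENNReal.ofReal_mul (by positivity),
          ENNReal.ofReal_ofNat]
        ring
  have h2 := (ENNReal.mul_le_mul_iff_right hV0 hVtop).1 h1
  have h3 : P ≤ ENNReal.ofReal (2 * 16 ^ p * M) / ENNReal.ofReal (Real.exp (l * τ / 2)) := by
    rw [ENNReal.le_div_iff_mul_le (Or.inl (by simp [Real.exp_pos])) (Or.inl (by simp)), mul_comm]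
    exact h2
  rw [← ENNReal.ofReal_div_of_pos (Real.exp_pos _)] at h3
  rwa [Real.exp_sub, ← hM, ← mul_div_assoc]

end OpNorm

/-! ### The three functionals as seminorms, and comparisons between them -/

section Norms

variable {p : ℕ}

/-- The absolute value of the trace, as a seminorm. -/
noncomputable def traceSeminorm (p : ℕ) : Seminorm ℝ (Matrix (Fin p) (Fin p) ℝ) :=
  (normSeminorm ℝ ℝ).comp (Matrix.traceLinearMap (Fin p) ℝ ℝ)

/-- The Frobenius norm, as a seminorm. -/
noncomputable def frobSeminorm (p : ℕ) : Seminorm ℝ (Matrix (Fin p) (Fin p) ℝ) :=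
  (normSeminorm ℝ (EuclideanSpace ℝ (Fin p × Fin p))).comp
    ({ toFun := fun A => WithLp.toLp 2 fun ij => A ij.1 ij.2
       map_add' := fun _ _ => rfl
       map_smul' := fun _ _ => rfl } :
      Matrix (Fin p) (Fin p) ℝ →ₗ[ℝ] EuclideanSpace ℝ (Fin p × Fin p))

/-- The operator norm, as a seminorm. -/
noncomputable def opSeminorm (p : ℕ) : Seminorm ℝ (Matrix (Fin p) (Fin p) ℝ) :=
  (normSeminorm ℝ (EuclideanSpace ℝ (Fin p) →L[ℝ] EuclideanSpace ℝ (Fin p))).comp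
    ({ toFun := fun A => Matrix.toEuclideanCLM (n := Fin p) (𝕜 := ℝ) A
       map_add' := fun _ _ => map_add _ _ _
       map_smul' := fun _ _ => map_smul _ _ _ } :
      Matrix (Fin p) (Fin p) ℝ →ₗ[ℝ] EuclideanSpace ℝ (Fin p) →L[ℝ] EuclideanSpace ℝ (Fin p))

lemma traceSeminorm_apply (A : Matrix (Fin p) (Fin p) ℝ) : traceSeminorm p A = |A.trace| := rfl

lemma opSeminorm_apply (A : Matrix (Fin p) (Fin p) ℝ) : opSeminorm p A = opNorm A := rfl

lemma frobSeminorm_apply (A : Matrix (Fin p) (Fin p) ℝ) : frobSeminorm p A = frobNorm A := by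
  change ‖(WithLp.toLp 2 fun ij : Fin p × Fin p => A ij.1 ij.2 :
    EuclideanSpace ℝ (Fin p × Fin p))‖ = _
  rw [EuclideanSpace.norm_eq, frobNorm, Fintype.sum_prod_type]
  simp [sq]

lemma frobNorm_sq (A : Matrix (Fin p) (Fin p) ℝ) : frobNorm A ^ 2 = ∑ i, ∑ j, A i j ^ 2 := by
  refine (Real.sq_sqrt (Finset.sum_nonneg fun i _ => Finset.sum_nonneg fun j _ =>
    mul_self_nonneg _)).trans ?_
  simp_rw [sq]

lemma traceSeminorm_vecMulVec_le (w : EuclideanSpace ℝ (Fin p)) :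
    traceSeminorm p (Matrix.vecMulVec w.ofLp w.ofLp) ≤ ‖w‖ ^ 2 := by
  rw [traceSeminorm_apply, EuclideanSpace.real_norm_sq_eq, Matrix.trace_vecMulVec, dotProduct]
  simp_rw [← sq]
  rw [abs_of_nonneg (Finset.sum_nonneg fun i _ => sq_nonneg _)]

lemma frobSeminorm_vecMulVec_le (w : EuclideanSpace ℝ (Fin p)) :
    frobSeminorm p (Matrix.vecMulVec w.ofLp w.ofLp) ≤ ‖w‖ ^ 2 := by
  rw [frobSeminorm_apply, EuclideanSpace.real_norm_sq_eq, frobNorm]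
  refine Real.sqrt_le_iff.2 ⟨Finset.sum_nonneg fun i _ => sq_nonneg _, ?_⟩
  rw [sq, Finset.sum_mul_sum]
  refine Finset.sum_le_sum fun i _ => Finset.sum_le_sum fun j _ => le_of_eq ?_
  rw [Matrix.vecMulVec_apply]
  ring

lemma opSeminorm_vecMulVec_le (w : EuclideanSpace ℝ (Fin p)) :
    opSeminorm p (Matrix.vecMulVec w.ofLp w.ofLp) ≤ ‖w‖ ^ 2 := by
  rw [opSeminorm_apply]
  refine ContinuousLinearMap.opNorm_le_bound _ (by positivity) fun x => ?_
  have h : Matrix.toEuclideanCLM (n := Fin p) (𝕜 := ℝ) (Matrix.vecMulVec w.ofLp w.ofLp) x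
      = ⟪w, x⟫ • w := by
    ext i
    rw [Matrix.ofLp_toEuclideanCLM, Matrix.vecMulVec_mulVec]
    simp [EuclideanSpace.inner_eq_star_dotProduct, dotProduct_comm, mul_comm]
  rw [h, norm_smul]
  calc ‖⟪w, x⟫‖ * ‖w‖ ≤ (‖w‖ * ‖x‖) * ‖w‖ := by gcongr; exact norm_inner_le_norm _ _
    _ = _ := by ring

lemma abs_frobNorm_sub_le (A B : Matrix (Fin p) (Fin p) ℝ) :
    |frobNorm A - frobNorm B| ≤ frobSeminorm p (A - B) := by
  rw [← frobSeminorm_apply, ← frobSeminorm_apply]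
  exact abs_sub_map_le_sub _ _ _

lemma abs_opNorm_sub_le (A B : Matrix (Fin p) (Fin p) ℝ) :
    |opNorm A - opNorm B| ≤ opSeminorm p (A - B) := by
  rw [← opSeminorm_apply, ← opSeminorm_apply]
  exact abs_sub_map_le_sub _ _ _

lemma trace_le_sqrt_mul_frobNorm (A : Matrix (Fin p) (Fin p) ℝ) :
    A.trace ≤ Real.sqrt p * frobNorm A := by
  rw [frobNorm, ← Real.sqrt_mul (Nat.cast_nonneg p)]
  apply Real.le_sqrt_of_sq_le
  have h := sq_sum_le_card_mul_sum_sq (s := Finset.univ) (f := fun i => A i i)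
  rw [Finset.card_univ, Fintype.card_fin] at h
  refine h.trans ?_
  gcongr with i
  rw [sq]
  exact Finset.single_le_sum (f := fun j => A i j * A i j) (fun j _ => mul_self_nonneg _)
    (Finset.mem_univ i)

/-- Column `j` is the image of a unit basis vector. Summing over `j` compares the Frobenius norm
with the operator norm. -/
lemma norm_toEuclideanCLM_single_le (A : Matrix (Fin p) (Fin p) ℝ) (j : Fin p) :
    ∑ i, A i j ^ 2 ≤ opNorm A ^ 2 := by
  have h := (Matrix.toEuclideanCLM (n := Fin p) (𝕜 := ℝ) A).le_opNorm (EuclideanSpace.single j 1)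
  rw [PiLp.norm_single, norm_one, mul_one] at h
  have h2 := pow_le_pow_left₀ (norm_nonneg _) h 2
  rw [EuclideanSpace.real_norm_sq_eq] at h2
  refine le_of_eq_of_le (Finset.sum_congr rfl fun i _ => ?_) h2
  rw [Matrix.ofLp_toEuclideanCLM]
  simp

lemma frobNorm_le_sqrt_mul_opNorm (A : Matrix (Fin p) (Fin p) ℝ) :
    frobNorm A ≤ Real.sqrt p * opNorm A := by
  rw [frobNorm, Finset.sum_comm]
  apply Real.sqrt_le_iff.2 ⟨by unfold opNorm; positivity, ?_⟩
  rw [mul_pow, Real.sq_sqrt (Nat.cast_nonneg p)]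
  calc ∑ j, ∑ i, A i j * A i j ≤ ∑ _j : Fin p, opNorm A ^ 2 := by
        refine Finset.sum_le_sum fun j _ => ?_
        simp_rw [← sq]
        exact norm_toEuclideanCLM_single_le A j
    _ = _ := by simp

lemma trace_le_mul_opNorm (A : Matrix (Fin p) (Fin p) ℝ) : A.trace ≤ p * opNorm A := by
  calc A.trace ≤ Real.sqrt p * frobNorm A := trace_le_sqrt_mul_frobNorm A
    _ ≤ Real.sqrt p * (Real.sqrt p * opNorm A) := by
        gcongr; exact frobNorm_le_sqrt_mul_opNorm A
    _ = _ := by rw [← mul_assoc, Real.mul_self_sqrt (Nat.cast_nonneg p)]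

end Norms

/-! ### Error decomposition of the sample covariance -/

section SampleCov

variable {p n : ℕ}

/-- Centring at the sample mean removes `v vᵀ / m` from the second moment matrix, where `v` is the
noise sum and `m = D.card`. The extra `S` is `m S - (m - 1) S`. -/
lemma sampleCov_sub_eq {D : Finset (Fin n)} (hD : 2 ≤ D.card) {X θ : Cols p n}
    {μ : EuclideanSpace ℝ (Fin p)} (hθ : ∀ t ∈ D, θ t = μ) (S : Matrix (Fin p) (Fin p) ℝ) :
    sampleCov D X - S = ((D.card : ℝ) - 1)⁻¹ • (centredSum S D (X - θ) + S
      - ((D.card : ℝ)⁻¹) • Matrix.vecMulVec (∑ t ∈ D, (X - θ) t).ofLp (∑ t ∈ D, (X - θ) t).ofLp) := by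
  have hm : (2 : ℝ) ≤ D.card := by exact_mod_cast hD
  have hm0 : (D.card : ℝ) ≠ 0 := by linarith
  have hm1 : (D.card : ℝ) - 1 ≠ 0 := by linarith
  set W := X - θ with hW
  set v := ∑ t ∈ D, W t with hv
  have hres : ∀ t ∈ D, X t - sampleMean D X = W t - (D.card : ℝ)⁻¹ • v := by
    intro t ht
    have h1 : ∑ t ∈ D, X t = v + (D.card : ℝ) • μ := by
      rw [hv, Nat.cast_smul_eq_nsmul ℝ, ← Finset.sum_const, ← Finset.sum_add_distrib]
      refine Finset.sum_congr rfl fun s hs => ?_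
      rw [hW, Pi.sub_apply, hθ s hs, sub_add_cancel]
    rw [sampleMean, h1, smul_add, inv_smul_smul₀ hm0, hW, Pi.sub_apply, hθ t ht]
    abel
  ext i j
  have hvi : ∀ i, ∑ t ∈ D, W t i = v i := fun i => by simp [hv]
  have hsum : (∑ t ∈ D, Matrix.vecMulVec (X t - sampleMean D X).ofLp
      (X t - sampleMean D X).ofLp) i j = ∑ t ∈ D, W t i * W t j - (D.card : ℝ)⁻¹ * (v i * v j) := by
    rw [Matrix.sum_apply]
    have h2 : ∀ t ∈ D, Matrix.vecMulVec (X t - sampleMean D X).ofLp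
        (X t - sampleMean D X).ofLp i j = W t i * W t j - (D.card : ℝ)⁻¹ * v j * W t i
          - (D.card : ℝ)⁻¹ * v i * W t j + (D.card : ℝ)⁻¹ ^ 2 * (v i * v j) := by
      intro t ht
      rw [hres t ht, Matrix.vecMulVec_apply]
      simp only [PiLp.sub_apply, PiLp.smul_apply, smul_eq_mul]
      ring
    rw [Finset.sum_congr rfl h2]
    simp only [Finset.sum_add_distrib, Finset.sum_sub_distrib, ← Finset.mul_sum, hvi,
      Finset.sum_const, nsmul_eq_mul]
    field_simp
    ring
  rw [Matrix.sub_apply, sampleCov, Matrix.smul_apply, hsum, Matrix.smul_apply, Matrix.sub_apply,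
    Matrix.add_apply, centredSum_apply, Matrix.smul_apply, Matrix.vecMulVec_apply]
  simp only [smul_eq_mul]
  field_simp
  ring

/-- Trace, Frobenius and operator norm all satisfy `hq`, so one triangle inequality serves the
three. Blocks of size at least two give `(m - 1)⁻¹ ≤ 2 / m`. -/
lemma seminorm_sampleCov_sub_le {D : Finset (Fin n)} (hD : 2 ≤ D.card) {X θ : Cols p n}
    {μ : EuclideanSpace ℝ (Fin p)} (hθ : ∀ t ∈ D, θ t = μ) (S : Matrix (Fin p) (Fin p) ℝ)
    (q : Seminorm ℝ (Matrix (Fin p) (Fin p) ℝ))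
    (hq : ∀ w : EuclideanSpace ℝ (Fin p), q (Matrix.vecMulVec w.ofLp w.ofLp) ≤ ‖w‖ ^ 2) :
    q (sampleCov D X - S) ≤ 2 / D.card * (q (centredSum S D (X - θ)) + q S
      + ‖∑ t ∈ D, (X - θ) t‖ ^ 2 / D.card) := by
  have hm : (2 : ℝ) ≤ D.card := by exact_mod_cast hD
  have hm0 : (0 : ℝ) < D.card := by linarith
  have hm1 : (0 : ℝ) < (D.card : ℝ) - 1 := by linarith
  rw [sampleCov_sub_eq hD hθ S, map_smul_eq_mul, Real.norm_eq_abs, abs_of_pos (inv_pos.2 hm1)]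
  have h1 : ((D.card : ℝ) - 1)⁻¹ ≤ 2 / D.card := by
    rw [inv_le_iff_one_le_mul₀ hm1, div_mul_eq_mul_div, le_div_iff₀ hm0]
    linarith
  have h2 := hq (∑ t ∈ D, (X - θ) t)
  set v := ∑ t ∈ D, (X - θ) t
  have h3 : q ((D.card : ℝ)⁻¹ • Matrix.vecMulVec v.ofLp v.ofLp) ≤ ‖v‖ ^ 2 / D.card := by
    rw [map_smul_eq_mul, Real.norm_eq_abs, abs_of_pos (inv_pos.2 hm0), div_eq_inv_mul]
    gcongr
  gcongr
  refine (map_sub_le_add q _ _).trans (add_le_add (map_add_le_add q _ _) h3)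

end SampleCov

/-! ### Probability bounds for the noise on one block -/

section Concentration

variable {p n : ℕ} {S : Matrix (Fin p) (Fin p) ℝ}

lemma measureReal_mul_le_le_inv {Ω : Type*} [MeasurableSpace Ω] {μ : Measure Ω}
    {f : Ω → ℝ} (hf : ∀ x, 0 ≤ f x) (hint : Integrable f μ) {a K : ℝ} (ha : 0 < a)
    (h : ∫ x, f x ∂μ ≤ a) (hK : 0 < K) : μ.real {x | K * a ≤ f x} ≤ K⁻¹ := by
  have := mul_meas_ge_le_integral_of_nonneg (Filter.Eventually.of_forall hf) hint (K * a)
  rw [← one_div, le_div_iff₀ hK]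
  have h2 : a * (μ.real {x | K * a ≤ f x} * K) ≤ a * 1 := by linarith
  exact le_of_mul_le_mul_left h2 ha

lemma noiseLaw_norm_sum_sq_le (hS : S.PosDef) (D : Finset (Fin n)) :
    Integrable (fun W : Cols p n => ‖∑ t ∈ D, W t‖ ^ 2) (noiseLaw n S) ∧
      ∫ W, ‖∑ t ∈ D, W t‖ ^ 2 ∂(noiseLaw n S) ≤ D.card * S.trace := by
  have h : ∀ W : Cols p n, ‖∑ t ∈ D, W t‖ ^ 2 = ∑ i, (∑ t ∈ D, W t i - 0) ^ 2 := by
    intro W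
    rw [EuclideanSpace.real_norm_sq_eq]
    simp
  simp_rw [h]
  have hi : ∀ i, Integrable (fun W : Cols p n => (∑ t ∈ D, W t i - 0) ^ 2) (noiseLaw n S) :=
    fun i => integrable_sq_sum_sub_pi _ (memLp_coord i) D 0
  refine ⟨integrable_finsetSum _ fun i _ => hi i, ?_⟩
  rw [integral_finsetSum _ fun i _ => hi i, Matrix.trace, Finset.mul_sum]
  refine Finset.sum_le_sum fun i _ => ?_
  have := integral_sq_sum_sub_pi_le (multivariateGaussian 0 S) (memLp_coord i) D
  rw [integral_coord, mul_zero] at this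
  refine this.trans (le_of_eq ?_)
  simp_rw [sq, integral_coord_mul hS.posSemidef]
  rfl

lemma noiseLaw_trace_centredSum_sq_le (hS : S.PosDef) (D : Finset (Fin n)) :
    Integrable (fun W : Cols p n => (centredSum S D W).trace ^ 2) (noiseLaw n S) ∧
      ∫ W, (centredSum S D W).trace ^ 2 ∂(noiseLaw n S)
        ≤ D.card * (gaussianFourthMoment * S.trace ^ 2) := by
  have h : ∀ W : Cols p n, (centredSum S D W).trace
      = ∑ t ∈ D, ∑ i, W t i * W t i
        - D.card * ∫ x : EuclideanSpace ℝ (Fin p), ∑ i, x i * x i ∂(multivariateGaussian 0 S) := by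
    intro W
    rw [integral_sum_coord_sq hS, Matrix.trace, Finset.sum_comm, Matrix.trace, Finset.mul_sum,
      ← Finset.sum_sub_distrib]
    exact Finset.sum_congr rfl fun i _ => centredSum_apply D W i i
  simp_rw [h]
  refine ⟨integrable_sq_sum_sub_pi _ (memLp_sum_coord_sq hS) D _, ?_⟩
  refine (integral_sq_sum_sub_pi_le _ (memLp_sum_coord_sq hS) D).trans ?_
  gcongr
  exact integral_sq_sum_coord_sq_le hS

/-- Entry `(i, j)` has variance at most a constant times `m * S i i * S j j`, where `m = D.card`,
and these products sum to the squared trace. -/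
lemma noiseLaw_frob_centredSum_sq_le (hS : S.PosDef) (D : Finset (Fin n)) :
    Integrable (fun W : Cols p n => frobNorm (centredSum S D W) ^ 2) (noiseLaw n S) ∧
      ∫ W, frobNorm (centredSum S D W) ^ 2 ∂(noiseLaw n S)
        ≤ D.card * (gaussianFourthMoment * S.trace ^ 2) := by
  have h : ∀ W : Cols p n, frobNorm (centredSum S D W) ^ 2
      = ∑ i, ∑ j, (∑ t ∈ D, W t i * W t j
        - D.card * ∫ x : EuclideanSpace ℝ (Fin p), x i * x j ∂(multivariateGaussian 0 S)) ^ 2 := by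
    intro W
    rw [frobNorm_sq]
    refine Finset.sum_congr rfl fun i _ => Finset.sum_congr rfl fun j _ => ?_
    rw [centredSum_apply, integral_coord_mul hS.posSemidef]
  simp_rw [h]
  have hi : ∀ i j, Integrable (fun W : Cols p n => (∑ t ∈ D, W t i * W t j
      - D.card * ∫ x : EuclideanSpace ℝ (Fin p), x i * x j ∂(multivariateGaussian 0 S)) ^ 2)
      (noiseLaw n S) := fun i j => integrable_sq_sum_sub_pi _ (memLp_coord_mul hS i j) D _
  refine ⟨integrable_finsetSum _ fun i _ => integrable_finsetSum _ fun j _ => hi i j, ?_⟩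
  rw [integral_finsetSum _ fun i _ => integrable_finsetSum _ fun j _ => hi i j]
  simp_rw [integral_finsetSum _ fun j _ => hi _ j]
  calc _ ≤ ∑ i, ∑ j, (D.card : ℝ) * (gaussianFourthMoment * (S i i * S j j)) := by
        refine Finset.sum_le_sum fun i _ => Finset.sum_le_sum fun j _ => ?_
        refine (integral_sq_sum_sub_pi_le _ (memLp_coord_mul hS i j) D).trans ?_
        gcongr
        exact integral_coord_mul_sq_le hS i j
    _ = _ := by
        simp_rw [← Finset.mul_sum, ← Finset.sum_mul, sq]
        rfl

lemma opNorm_pos (hS : S.PosDef) (hp : 1 ≤ p) : 0 < opNorm S := by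
  have i : Fin p := ⟨0, hp⟩
  have hi : 0 < S i i := hS.diag_pos
  have h1 := norm_toEuclideanCLM_single_le S i
  have h2 : S i i ^ 2 ≤ ∑ k, S k i ^ 2 :=
    Finset.single_le_sum (f := fun k => S k i ^ 2) (fun k _ => sq_nonneg _) (Finset.mem_univ i)
  have h3 : 0 ≤ opNorm S := norm_nonneg _
  refine lt_of_le_of_ne h3 fun h0 => ?_
  rw [← h0] at h1
  nlinarith

lemma trace_pos (hS : S.PosDef) (hp : 1 ≤ p) : 0 < S.trace :=
  Finset.sum_pos (fun _ _ => hS.diag_pos) ⟨⟨0, hp⟩, Finset.mem_univ _⟩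

/-- The operator norm of the centred second moment matrix is of order `‖Σ‖ √(p m)`. -/
lemma exists_noiseLaw_opNorm_le {c δ : ℝ} (hc : 0 < c) (hδ : 0 < δ) :
    ∃ K₀ : ℝ, 0 < K₀ ∧ ∀ K, K₀ ≤ K → ∀ (p n : ℕ) (S : Matrix (Fin p) (Fin p) ℝ) (D : Finset (Fin n)),
      1 ≤ p → S.PosDef → 0 < D.card → (p : ℝ) ≤ c * D.card →
      (noiseLaw n S).real {W | K * (opNorm S * Real.sqrt (p * D.card))
        ≤ opNorm (centredSum S D W)} ≤ δ := by
  -- The exponent will be `l = a * r / s`, with `r = √(p / D.card) ≤ 1 + c`. This `a` makes `4 * l *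
  -- s ≤ 1 / 4`, the range of the chi-square bound.
  set a : ℝ := 1 / (16 * (1 + c)) with ha
  have ha0 : 0 < a := by positivity
  have ha1 : a ≤ 1 / 16 := by
    rw [ha]
    apply one_div_le_one_div_of_le (by norm_num)
    linarith
  have hlog : 0 < Real.log 16 := Real.log_pos (by norm_num)
  -- Thus `K * a / 2` pays for the factor `16 ^ p`, for the quadratic term `64 * a ^ 2 ≤ 1`, and
  -- leaves `2 / δ`.
  refine ⟨2 * (Real.log 16 + 1 + 2 / δ) / a, by positivity, ?_⟩
  intro K hK p n S D hp hS hD hpc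
  have hKa : 2 * (Real.log 16 + 1 + 2 / δ) ≤ K * a := by rwa [div_le_iff₀ ha0] at hK
  have hK0 : 0 < K := lt_of_lt_of_le (by positivity) hK
  have hm : (0 : ℝ) < D.card := by exact_mod_cast hD
  have hp1 : (1 : ℝ) ≤ p := by exact_mod_cast hp
  have hp0 : (0 : ℝ) < p := by linarith
  have hs := opNorm_pos hS hp
  set s := opNorm S with hsdef
  set r : ℝ := Real.sqrt (p / D.card) with hr
  have hr0 : 0 < r := Real.sqrt_pos.2 (by positivity)
  have hr2 : r ^ 2 * D.card = p := by
    rw [hr, Real.sq_sqrt (by positivity)]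
    field_simp
  have hrc : r ≤ 1 + c := by
    apply Real.sqrt_le_iff.2 ⟨by positivity, ?_⟩
    rw [div_le_iff₀ hm]
    refine hpc.trans ?_
    gcongr
    nlinarith
  have hrm : Real.sqrt (p * D.card) = r * D.card := by
    rw [hr, ← Real.sqrt_sq hm.le, ← Real.sqrt_mul (by positivity), Real.sqrt_sq hm.le]
    congr 1
    field_simp
  have hls : a * r / s * (s * 4) ≤ 1 / 4 := by
    have h1 : a * r / s * (s * 4) = 4 * (a * r) := by field_simp
    have h2 : a * r ≤ a * (1 + c) := by gcongr
    have h3 : a * (1 + c) = 1 / 16 := by rw [ha]; field_simp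
    linarith
  have hmain := noiseLaw_opNorm_centredSum_le hS.posSemidef D (l := a * r / s)
    (τ := K * (s * Real.sqrt (p * D.card))) (by positivity) (by positivity) hls
  have hreal : (noiseLaw n S).real {W | K * (s * Real.sqrt (p * D.card))
      ≤ opNorm (centredSum S D W)} ≤ 2 * 16 ^ p
        * Real.exp (64 * (a * r / s * s) ^ 2 * D.card
          - a * r / s * (K * (s * Real.sqrt (p * D.card))) / 2) :=
    ENNReal.toReal_le_of_le_ofReal (by positivity) hmain
  refine hreal.trans ?_
  -- Since `r ^ 2 * D.card = p`, both terms of the exponent are proportional to `p`, and so can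
  -- compete with `16 ^ p`.
  have hexp : 64 * (a * r / s * s) ^ 2 * D.card
      - a * r / s * (K * (s * Real.sqrt (p * D.card))) / 2 = p * (64 * a ^ 2 - K * a / 2) := by
    rw [hrm, div_mul_cancel₀ _ hs.ne', ← hr2]
    field_simp
  have h16 : (16 : ℝ) ^ p = Real.exp (p * Real.log 16) := by
    rw [Real.exp_nat_mul, Real.exp_log (by norm_num)]
  rw [hexp, h16, mul_assoc, ← Real.exp_add, ← mul_add]
  have hle : p * (Real.log 16 + (64 * a ^ 2 - K * a / 2)) ≤ -(2 / δ) := by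
    have h1 : Real.log 16 + (64 * a ^ 2 - K * a / 2) ≤ -(2 / δ) := by nlinarith
    have h2 : 0 < 2 / δ := by positivity
    nlinarith
  have hfin : Real.exp (-(2 / δ)) ≤ δ / 2 := by
    rw [Real.exp_neg, inv_le_comm₀ (Real.exp_pos _) (by positivity), inv_div]
    linarith [Real.add_one_le_exp (2 / δ)]
  calc 2 * Real.exp (p * (Real.log 16 + (64 * a ^ 2 - K * a / 2))) ≤ 2 * Real.exp (-(2 / δ)) := by
        gcongr
    _ ≤ _ := by linarith

/-- The event on which the sample covariance matrix of the centred columns in `D` is close to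
`Σ`. -/
def goodEvent (S : Matrix (Fin p) (Fin p) ℝ) (D : Finset (Fin n)) (K : ℝ) : Set (Cols p n) :=
  {W | ‖∑ t ∈ D, W t‖ ^ 2 ≤ K * (D.card * S.trace) ∧
    (centredSum S D W).trace ^ 2 ≤ K * (D.card * S.trace ^ 2) ∧
    frobNorm (centredSum S D W) ^ 2 ≤ K * (D.card * S.trace ^ 2) ∧
    opNorm (centredSum S D W) ≤ K * (opNorm S * Real.sqrt (p * D.card))}

lemma exists_noiseLaw_compl_goodEvent_le {c δ : ℝ} (hc : 0 < c) (hδ : 0 < δ) :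
    ∃ K : ℝ, 0 < K ∧ ∀ (p n : ℕ) (S : Matrix (Fin p) (Fin p) ℝ) (D : Finset (Fin n)),
      1 ≤ p → S.PosDef → 0 < D.card → (p : ℝ) ≤ c * D.card →
      (noiseLaw n S).real (goodEvent S D K)ᶜ ≤ δ := by
  obtain ⟨K₀, hK₀, hop⟩ := exists_noiseLaw_opNorm_le hc (δ := δ / 4) (by positivity)
  have hκ := gaussianFourthMoment_nonneg
  set κ := gaussianFourthMoment with hκdef
  set R : ℝ := 4 / δ with hR
  have hR0 : 0 < R := by positivity
  -- Each of the four conditions may fail with probability `δ / 4`. Using `κ + 1` keeps the Markov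
  -- thresholds positive, as only `0 ≤ κ` is known.
  refine ⟨K₀ + R * (κ + 1), by positivity, ?_⟩
  intro p n S D hp hS hD hpc
  have hm : (0 : ℝ) < D.card := by exact_mod_cast hD
  have ht := trace_pos hS hp
  set K := K₀ + R * (κ + 1) with hK
  have hKR : R ≤ K := by nlinarith [mul_nonneg hR0.le hκ]
  have hKRκ : R * (κ + 1) ≤ K := by linarith
  have hRinv : R⁻¹ = δ / 4 := by rw [hR, inv_div]
  obtain ⟨i1, b1⟩ := noiseLaw_norm_sum_sq_le hS D
  obtain ⟨i2, b2⟩ := noiseLaw_trace_centredSum_sq_le hS D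
  obtain ⟨i3, b3⟩ := noiseLaw_frob_centredSum_sq_le hS D
  have hκ1 : (D.card : ℝ) * (κ * S.trace ^ 2) ≤ D.card * ((κ + 1) * S.trace ^ 2) := by
    gcongr; linarith
  have m1 := measureReal_mul_le_le_inv (fun W => by positivity) i1 (by positivity) b1 hR0
  have m2 := measureReal_mul_le_le_inv (fun W => by positivity) i2
    (a := D.card * ((κ + 1) * S.trace ^ 2)) (by positivity) (b2.trans hκ1) hR0
  have m3 := measureReal_mul_le_le_inv (fun W => by positivity) i3
    (a := D.card * ((κ + 1) * S.trace ^ 2)) (by positivity) (b3.trans hκ1) hR0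
  have m4 := hop K (by nlinarith [mul_nonneg hR0.le hκ]) p n S D hp hS hD hpc
  rw [hRinv] at m1 m2 m3
  set A1 := {W : Cols p n | R * (D.card * S.trace) ≤ ‖∑ t ∈ D, W t‖ ^ 2}
  set A2 := {W : Cols p n | R * (D.card * ((κ + 1) * S.trace ^ 2)) ≤ (centredSum S D W).trace ^ 2}
  set A3 := {W : Cols p n | R * (D.card * ((κ + 1) * S.trace ^ 2))
    ≤ frobNorm (centredSum S D W) ^ 2}
  set A4 := {W : Cols p n | K * (opNorm S * Real.sqrt (p * D.card)) ≤ opNorm (centredSum S D W)}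
  have hsub : (goodEvent S D K)ᶜ ⊆ (A1 ∪ A2) ∪ (A3 ∪ A4) := by
    intro W hW
    by_contra hnot
    simp only [Set.mem_union, not_or] at hnot
    obtain ⟨⟨n1, n2⟩, n3, n4⟩ := hnot
    simp only [A1, A2, A3, A4, Set.mem_ofPred_eq, not_le] at n1 n2 n3 n4
    have e : R * (D.card * ((κ + 1) * S.trace ^ 2)) = R * (κ + 1) * (D.card * S.trace ^ 2) := by ring
    rw [e] at n2 n3
    refine hW ⟨n1.le.trans ?_, n2.le.trans ?_, n3.le.trans ?_, n4.le⟩ <;> gcongr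
  calc (noiseLaw n S).real (goodEvent S D K)ᶜ
      ≤ (noiseLaw n S).real ((A1 ∪ A2) ∪ (A3 ∪ A4)) := measureReal_mono hsub
    _ ≤ _ := by
      have u := measureReal_union_le (μ := noiseLaw n S) (A1 ∪ A2) (A3 ∪ A4)
      have u1 := measureReal_union_le (μ := noiseLaw n S) A1 A2
      have u2 := measureReal_union_le (μ := noiseLaw n S) A3 A4
      linarith

end Concentration

/-! ### From the good event to the stated bounds -/

section Deterministic

variable {p n : ℕ} {S : Matrix (Fin p) (Fin p) ℝ}

lemma sqrt_mul_le_of_sq_le {x K m T : ℝ} (hK : 0 ≤ K) (hm : 0 ≤ m) (hT : 0 ≤ T)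
    (h : x ^ 2 ≤ K * (m * T ^ 2)) : |x| ≤ (1 + K) * (Real.sqrt m * T) := by
  apply abs_le_of_sq_le_sq _ (by positivity)
  rw [mul_pow, mul_pow, Real.sq_sqrt hm]
  refine h.trans ?_
  gcongr
  nlinarith

/-- Here `u = √m` and `v = √n` with `n = 3 m`, hence `v ≤ 2 * u`. This trades the block size for
`n`. -/
lemma le_div_sqrt_of_le {c K m u v Y B : ℝ} (hc : 0 < c) (hK : 0 < K) (hu : 0 < u) (hv : 0 < v)
    (hum : u * u = m) (hvu : v ≤ 2 * u) (hB : 0 ≤ B)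
    (hY : Y ≤ 2 / m * (2 * (K + 1) * (1 + c) * (u * B))) :
    Y ≤ 8 * (K + 1) * (1 + c) * (B / v) := by
  have huinv : 1 / u ≤ 2 / v := by
    rw [div_le_div_iff₀ hu hv]
    linarith
  calc Y ≤ 2 / m * (2 * (K + 1) * (1 + c) * (u * B)) := hY
    _ = 4 * (K + 1) * (1 + c) * B * (1 / u) := by rw [← hum]; field_simp; ring
    _ ≤ 4 * (K + 1) * (1 + c) * B * (2 / v) := by gcongr
    _ = _ := by ring

/-- With `r = √p`, `u = √m`, and `T` the trace, the delicate term is the sample mean correction `K *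
T`. It is of order `p * s`, and `r ≤ (1 + c) * u` brings it down to `√(p m) * s`. -/
lemma opNorm_error_le {c K s r u T P x : ℝ} (hc : 0 < c) (hK : 0 < K) (hs : 0 < s) (hr : 1 ≤ r)
    (hu : 1 ≤ u) (hru : r ≤ (1 + c) * u) (hrP : r * r = P) (hT : T ≤ P * s)
    (hx : x ≤ K * (s * (r * u))) :
    x + s + K * T ≤ 2 * (K + 1) * (1 + c) * (u * (s * r)) := by
  have h0 : K * T ≤ K * ((1 + c) * (u * (s * r))) := by
    gcongr
    calc T ≤ P * s := hT
      _ = r * (s * r) := by rw [← hrP]; ring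
      _ ≤ ((1 + c) * u) * (s * r) := by gcongr
      _ = _ := by ring
  have h2 : s ≤ u * (s * r) := by
    calc s = 1 * (s * 1) := by ring
      _ ≤ u * (s * r) := by gcongr
  have h3 : 0 ≤ (K * c + 2 * c) * (u * (s * r)) := by positivity
  linarith

lemma le_one_add_sq {c : ℝ} (hc : 0 ≤ c) : c ≤ (1 + c) ^ 2 := by nlinarith

lemma error_le {c K u T F B x : ℝ} (hc : 0 < c) (hK : 0 < K) (hu : 1 ≤ u) (hT : T ≤ B)
    (hF : F ≤ B) (hB : 0 ≤ B) (hx : x ≤ (1 + K) * (u * T)) :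
    x + F + K * T ≤ 2 * (K + 1) * (1 + c) * (u * B) := by
  have h0 : 0 ≤ (K + 1) * c * (u * B) := by positivity
  have h1 : B ≤ u * B := le_mul_of_one_le_left hB hu
  have h2 : K * T ≤ K * (u * B) := by
    gcongr; linarith
  have h3 : (1 + K) * (u * T) ≤ (1 + K) * (u * B) := by gcongr
  linarith

/-- The bounds on the functionals of the sample covariance matrix implied by `goodEvent`. -/
lemma sampleCov_bounds {D : Finset (Fin n)} {c K : ℝ} (hc : 0 < c) (hK : 0 < K) (hp : 1 ≤ p)
    (hS : S.PosDef) (hD : 2 ≤ D.card) (hn : n = 3 * D.card) (hpc : (p : ℝ) ≤ c * D.card)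
    {X θ : Cols p n} {μ : EuclideanSpace ℝ (Fin p)} (hθ : ∀ t ∈ D, θ t = μ)
    (hX : X - θ ∈ goodEvent S D K) :
    |(sampleCov D X).trace - S.trace| ≤ 8 * (K + 1) * (1 + c) * (Real.sqrt p * frobNorm S / Real.sqrt n
        + p * opNorm S / n) ∧
    |frobNorm (sampleCov D X) - frobNorm S| ≤
      8 * (K + 1) * (1 + c) * opNorm S * Real.sqrt ((p : ℝ) ^ 2 / n) ∧
    |opNorm (sampleCov D X) - opNorm S| ≤
      8 * (K + 1) * (1 + c) * opNorm S * Real.sqrt ((p : ℝ) / n) := by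
  obtain ⟨g1, g2, g3, g4⟩ := hX
  have hm2 : (2 : ℝ) ≤ D.card := by exact_mod_cast hD
  have hnm : (n : ℝ) = 3 * D.card := by exact_mod_cast hn
  set m : ℝ := (D.card : ℝ) with hmdef
  have hm : 0 < m := by linarith
  have hp1 : (1 : ℝ) ≤ p := by exact_mod_cast hp
  have hs := opNorm_pos hS hp
  have ht := trace_pos hS hp
  have hf : 0 ≤ frobNorm S := Real.sqrt_nonneg _
  have tf := trace_le_sqrt_mul_frobNorm S
  have ts := trace_le_mul_opNorm S
  have fs := frobNorm_le_sqrt_mul_opNorm S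
  set s := opNorm S
  set T := S.trace
  have q1 := seminorm_sampleCov_sub_le hD hθ S _ traceSeminorm_vecMulVec_le (X := X)
  have q2 := seminorm_sampleCov_sub_le hD hθ S _ frobSeminorm_vecMulVec_le (X := X)
  have q3 := seminorm_sampleCov_sub_le hD hθ S _ opSeminorm_vecMulVec_le (X := X)
  have gv : ‖∑ t ∈ D, (X - θ) t‖ ^ 2 / m ≤ K * T := by
    rw [div_le_iff₀ hm]
    linarith
  have g2' := sqrt_mul_le_of_sq_le hK.le hm.le ht.le g2
  have g3' := (le_abs_self _).trans (sqrt_mul_le_of_sq_le hK.le hm.le ht.le g3)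
  rw [traceSeminorm_apply _, traceSeminorm_apply (centredSum _ _ _), traceSeminorm_apply S,
    abs_of_pos ht, Matrix.trace_sub] at q1
  rw [frobSeminorm_apply (centredSum _ _ _), frobSeminorm_apply S] at q2
  rw [opSeminorm_apply (centredSum _ _ _), opSeminorm_apply S] at q3
  replace q2 := (abs_frobNorm_sub_le _ _).trans q2
  replace q3 := (abs_opNorm_sub_le _ _).trans q3
  set u := Real.sqrt m with hu
  have hu1 : 1 ≤ u := by
    rw [hu, Real.one_le_sqrt]; linarith
  have hu0 : 0 < u := by linarith
  have hum : u * u = m := Real.mul_self_sqrt hm.le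
  have hrp : 1 ≤ Real.sqrt p := by rwa [Real.one_le_sqrt]
  have hrpp : Real.sqrt p * Real.sqrt p = p := Real.mul_self_sqrt (by linarith)
  set rp := Real.sqrt p with hrpdef
  have hsn : Real.sqrt n ≤ 2 * u := by
    rw [hnm, hu]
    apply Real.sqrt_le_iff.2 ⟨by positivity, ?_⟩
    rw [mul_pow, Real.sq_sqrt hm.le]
    linarith
  have hn0 : (0 : ℝ) < n := by rw [hnm]; linarith
  have hsn0 : 0 < Real.sqrt n := Real.sqrt_pos.2 hn0
  have hpn : Real.sqrt ((p : ℝ) / n) = rp / Real.sqrt n := Real.sqrt_div (by linarith) _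
  have hp2n : Real.sqrt ((p : ℝ) ^ 2 / n) = p / Real.sqrt n := by
    rw [Real.sqrt_div (by positivity), Real.sqrt_sq (by linarith)]
  have hconv : ∀ Y B : ℝ, 0 ≤ B → Y ≤ 2 / m * (2 * (K + 1) * (1 + c) * (u * B)) →
      Y ≤ 8 * (K + 1) * (1 + c) * (B / Real.sqrt n) :=
    fun Y B hB hY => le_div_sqrt_of_le hc hK hu0 hsn0 hum hsn hB hY
  refine ⟨?_, ?_, ?_⟩
  · have h1 := hconv _ T ht.le (q1.trans (mul_le_mul_of_nonneg_left
      ((add_le_add_right gv _).trans (error_le hc hK hu1 le_rfl le_rfl ht.le g2'))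
      (by positivity)))
    refine h1.trans ?_
    -- The first term of the target already dominates `T / √n`; the second is only added as a
    -- nonnegative quantity.
    have h3 : 0 ≤ p * s / n := by positivity
    have h4 : T / Real.sqrt n ≤ rp * frobNorm S / Real.sqrt n := by gcongr
    gcongr
    linarith
  · have hTp : T ≤ s * p := by linarith
    have hfp : frobNorm S ≤ s * p := by
      refine fs.trans ?_
      rw [← hrpp]
      calc rp * s = s * (rp * 1) := by ring
        _ ≤ s * (rp * rp) := by gcongr
    have h1 := hconv _ (s * p) (ht.le.trans hTp) (q2.trans (mul_le_mul_of_nonneg_left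
      ((add_le_add_right gv _).trans (error_le hc hK hu1 hTp hfp (ht.le.trans hTp) g3'))
      (by positivity)))
    rw [hp2n]
    refine h1.trans (le_of_eq (by ring))
  · have hrpu : rp ≤ (1 + c) * u := by
      rw [hrpdef]
      apply Real.sqrt_le_iff.2 ⟨by positivity, ?_⟩
      rw [mul_pow, sq u, hum]
      exact hpc.trans (mul_le_mul_of_nonneg_right (le_one_add_sq hc.le) hm.le)
    have hspm : Real.sqrt (p * m) = rp * u := Real.sqrt_mul (by linarith) _
    rw [hspm] at g4
    have h1 := hconv _ (s * rp) (mul_nonneg hs.le (by linarith)) (q3.trans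
      (mul_le_mul_of_nonneg_left ((add_le_add_right gv _).trans
        (opNorm_error_le hc hK hs hrp hu1 hrpu hrpp ts g4)) (by positivity)))
    rw [hpn]
    refine h1.trans (le_of_eq (by ring))

end Deterministic

/-! ### Robustness of the median to one spoiled block -/

section Median

/-- If all but one of three numbers lie within `r` of `x`, then so does their median. -/
lemma abs_median_sub_le {a : Fin 3 → ℝ} {x r : ℝ} (j₀ : Fin 3)
    (h : ∀ j, j ≠ j₀ → |a j - x| ≤ r) : |median a - x| ≤ r := by
  set σ := Tuple.sort a
  have hmono : Monotone (a ∘ σ) := Tuple.monotone_sort a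
  have h01 : a (σ 0) ≤ a (σ 1) := hmono (by decide)
  have h12 : a (σ 1) ≤ a (σ 2) := hmono (by decide)
  change |a (σ 1) - x| ≤ r
  -- If the middle entry is the exceptional one, it is squeezed between two good entries.
  by_cases hj : σ 1 = j₀
  · have h0 := abs_le.1 (h (σ 0) (by rw [← hj]; exact fun e => absurd (σ.injective e) (by decide)))
    have h2 := abs_le.1 (h (σ 2) (by rw [← hj]; exact fun e => absurd (σ.injective e) (by decide)))
    exact abs_le.2 ⟨by linarith [h0.1], by linarith [h2.2]⟩
  · exact h _ hj

lemma card_block {n : ℕ} (hn : 3 ∣ n) (j : Fin 3) : (block n j).card = n / 3 := by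
  have hmap : (block n j).map Fin.valEmbedding
      = Finset.Ico ((j : ℕ) * (n / 3)) (((j : ℕ) + 1) * (n / 3)) := by
    ext t
    simp only [block, Finset.mem_map, Finset.mem_filter, Finset.mem_univ, true_and,
      Fin.valEmbedding_apply, Finset.mem_Ico]
    constructor
    · rintro ⟨a, ha, rfl⟩
      exact ha
    · intro ht
      have h3 : ((j : ℕ) + 1) * (n / 3) ≤ 3 * (n / 3) := Nat.mul_le_mul_right _ (by omega)
      exact ⟨⟨t, by omega⟩, ht, rfl⟩
  rw [← Finset.card_map Fin.valEmbedding, hmap, Nat.card_Ico, Nat.succ_mul, Nat.add_sub_cancel_left]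

/-- A mean matrix with at most one changepoint is constant on all but one of the blocks. -/
lemma exists_const_on_blocks {p n : ℕ} (hn : 3 ∣ n) {θ : Cols p n} (hθ : θ ∈ paramSpace p n p) :
    ∃ j₀ : Fin 3, ∀ j, j ≠ j₀ → ∃ μ, ∀ t ∈ block n j, θ t = μ := by
  rcases hθ with ⟨μ, hμ⟩ | hθ
  · exact ⟨0, fun j _ => ⟨μ, fun t _ => hμ t⟩⟩
  · simp only [Set.mem_iUnion] at hθ
    obtain ⟨ρ, -, t₀, ht1, htn, μ₁, μ₂, h1, h2, -⟩ := hθ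
    obtain ⟨m, rfl⟩ := hn
    have hm : 0 < m := by omega
    have hdiv : 3 * m / 3 = m := by omega
    have hlt : t₀ / m < 3 := (Nat.div_lt_iff_lt_mul hm).2 htn
    -- Zero-based index `t₀` is the first with mean `μ₂`, so the block containing it is discarded,
    -- even when the change falls exactly on its boundary.
    refine ⟨⟨t₀ / m, hlt⟩, fun j hj => ?_⟩
    have hle : t₀ / m * m ≤ t₀ := Nat.div_mul_le_self _ _
    have hgt : t₀ < (t₀ / m + 1) * m := by
      rw [Nat.mul_comm]; exact Nat.lt_mul_div_succ _ hm
    have hne : (j : ℕ) ≠ t₀ / m := fun e => hj (Fin.ext e)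
    rcases lt_or_gt_of_ne hne with hlt' | hgt'
    · refine ⟨μ₁, fun t ht => h1 t ?_⟩
      simp only [block, Finset.mem_filter, Finset.mem_univ, true_and, hdiv] at ht
      have : ((j : ℕ) + 1) * m ≤ t₀ / m * m := Nat.mul_le_mul_right _ hlt'
      omega
    · refine ⟨μ₂, fun t ht => h2 t ?_⟩
      simp only [block, Finset.mem_filter, Finset.mem_univ, true_and, hdiv] at ht
      have : (t₀ / m + 1) * m ≤ (j : ℕ) * m := Nat.mul_le_mul_right _ hgt'
      omega

end Median

lemma dataLaw_real_preimage_le {p n : ℕ} (S : Matrix (Fin p) (Fin p) ℝ) (θ : Cols p n)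
    (B : Set (Cols p n)) : (dataLaw S θ).real {X | X - θ ∈ B} ≤ (noiseLaw n S).real B :=
  ENNReal.toReal_mono (measure_ne_top _ _) (dataLaw_preimage_le S θ B)

/-- Subadditivity on `A ∪ Aᶜ` suffices, so `A` need not be measurable. -/
lemma one_sub_le_measureReal {Ω : Type*} [MeasurableSpace Ω] (μ : Measure Ω)
    [IsProbabilityMeasure μ] {A : Set Ω} {δ : ℝ} (h : μ.real Aᶜ ≤ δ) : 1 - δ ≤ μ.real A := by
  have := measureReal_union_le (μ := μ) A Aᶜ
  rw [Set.union_compl_self, probReal_univ] at this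
  linarith

end Changepoint

/-! ### Assembly: union bound over the blocks and passage to the median -/

theorem mainTheorem6 (c ε : ℝ) (hc : 0 < c) (hε : 0 < ε) :
    ∃ C : ℝ, 0 < C ∧
      ∀ (p n : ℕ), 6 ≤ n → 3 ∣ n → (p : ℝ) ≤ c * (n : ℝ) →
      ∀ (S : Matrix (Fin p) (Fin p) ℝ), S.PosDef →
      ∀ θ ∈ Changepoint.paramSpace p n p,
        1 - ε / 4 ≤ (Changepoint.dataLaw S θ).real
          {X : Changepoint.Cols p n |
            |Changepoint.medianOver Matrix.trace X - Matrix.trace S| ≤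
                C * (Real.sqrt p * Changepoint.frobNorm S / Real.sqrt n
                  + (p : ℝ) * Changepoint.opNorm S / (n : ℝ)) ∧
            |Changepoint.medianOver Changepoint.frobNorm X - Changepoint.frobNorm S| ≤
                C * Changepoint.opNorm S * Real.sqrt ((p : ℝ) ^ 2 / (n : ℝ)) ∧
            |Changepoint.medianOver Changepoint.opNorm X - Changepoint.opNorm S| ≤
                C * Changepoint.opNorm S * Real.sqrt ((p : ℝ) / (n : ℝ))} := by
  -- In terms of the block size, `p ≤ c * n` reads `p ≤ 3 * c * (n / 3)`. Three failures of
  -- probability `ε / 12` add up to `ε / 4`.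
  obtain ⟨K, hK, hgood⟩ := Changepoint.exists_noiseLaw_compl_goodEvent_le
    (c := 3 * c) (δ := ε / 12) (by positivity) (by positivity)
  refine ⟨8 * (K + 1) * (1 + 3 * c), by positivity, ?_⟩
  intro p n hn hn3 hpc S hS θ hθ
  apply Changepoint.one_sub_le_measureReal
  -- For `p = 0` the strict positivity of trace and operator norm fails, but there is only one empty
  -- matrix and all errors vanish.
  rcases Nat.eq_zero_or_pos p with rfl | hp
  · have hmed : ∀ (F : Matrix (Fin 0) (Fin 0) ℝ → ℝ) (X : Changepoint.Cols 0 n),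
        |Changepoint.medianOver F X - F S| ≤ 0 := fun F X =>
      Changepoint.abs_median_sub_le 0 fun j _ => by
        rw [Subsingleton.elim (Changepoint.sampleCov (Changepoint.block n j) X) S]; simp
    have huniv : ∀ A : Set (Changepoint.Cols 0 n), (∀ X, X ∈ A) →
        (Changepoint.dataLaw S θ).real Aᶜ ≤ ε / 4 := fun A hA => by
      rw [Set.eq_univ_of_forall hA, Set.compl_univ, measureReal_empty]
      positivity
    refine huniv _ fun X => ⟨(hmed Matrix.trace X).trans ?_,
      (hmed Changepoint.frobNorm X).trans ?_, (hmed Changepoint.opNorm X).trans ?_⟩ <;> simp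
  · obtain ⟨j₀, hconst⟩ := Changepoint.exists_const_on_blocks hn3 hθ
    have hcard := Changepoint.card_block hn3
    have hn' : n = 3 * (n / 3) := by omega
    have hnr : (n : ℝ) = 3 * ((n / 3 : ℕ) : ℝ) := by exact_mod_cast hn'
    have hpc' : ∀ j, (p : ℝ) ≤ 3 * c * (Changepoint.block n j).card := fun j => by
      rw [hcard, mul_comm (3 : ℝ), mul_assoc, ← hnr]; exact hpc
    set B : Fin 3 → Set (Changepoint.Cols p n) := fun j =>
      {X | X - θ ∈ (Changepoint.goodEvent S (Changepoint.block n j) K)ᶜ} with hB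
    have hBle : ∀ j, (Changepoint.dataLaw S θ).real (B j) ≤ ε / 12 := fun j =>
      (Changepoint.dataLaw_real_preimage_le S θ _).trans
        (hgood p n S _ hp hS (by rw [hcard]; omega) (hpc' j))
    have hunion : (Changepoint.dataLaw S θ).real (⋃ j, B j) ≤ ε / 4 := by
      refine (measureReal_iUnion_fintype_le B).trans ?_
      calc _ ≤ ∑ _j : Fin 3, ε / 12 := Finset.sum_le_sum fun j _ => hBle j
        _ = ε / 4 := by simp; ring
    refine (measureReal_mono (Set.compl_subset_comm.1 fun X hX => ?_)).trans hunion
    have hb : ∀ j, j ≠ j₀ → _ := fun j hj =>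
      Changepoint.sampleCov_bounds (D := Changepoint.block n j) (c := 3 * c) (K := K) (X := X)
        (by positivity) hK hp hS (by rw [hcard]; omega) (by rw [hcard]; exact hn') (hpc' j)
        (hconst j hj).choose_spec (by
          by_contra hX'
          exact hX (Set.mem_iUnion.2 ⟨j, hX'⟩))
    exact ⟨Changepoint.abs_median_sub_le j₀ fun j hj => (hb j hj).1,
      Changepoint.abs_median_sub_le j₀ fun j hj => (hb j hj).2.1,
      Changepoint.abs_median_sub_le j₀ fun j hj => (hb j hj).2.2⟩
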